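/- A set $S$ of vertices of a finite simple graph $G=(V,E)$ is a dominating set of $G$ if every vertex of $V$ belongs to $S$ or has a neighbour in $S$; it is a minimal dominating set if no proper subset of $S$ is a dominating set of $G$. A simple branching algorithm is a program of a unit-cost random access machine (registers and two-dimensional arrays of natural numbers, addition and truncated subtraction, assignments, tests and loops) with one additional command that splits the computation into two branches. Each branch continues with its own copy of the memory, so that the exploration of one root-to-leaf path of the resulting search tree is independent of the other paths, and each branch outputs at most one vertex set when it halts. The running time of the algorithm is the total number of steps on all branches, that is, the number of nodes of the search tree (in which every single step is a node). The input is a graph $G$ on $n$ vertices, given by $n$ and its adjacency matrix, together with a vertex subset $X$, given by its indicator vector. **Theorem.** There is a simple branching algorithm $A$ such that for every real $d>0$ there is an $\varepsilon_d$ with $0<\varepsilon_d<1$ for which the following hold. 1. There is a polynomial $p$ such that for every finite graph $G=(V,E)$, with $n=|V|$, and every $X\subseteq V$ with $|X|\ge d\cdot |V|$, the algorithm $A$ on input $(G,X)$ halts on every branch and outputs every minimal dominating set of $G$ that is a subset of $X$ exactly once, and nothing else; every root-to-leaf path of its search tree has at most $p(n)$ steps, and its running time is at most $p(n)\cdot(2-\varepsilon_d)^{|X|}$,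 that is, $O^*\left((2-\varepsilon_d)^{|X|}\right)$. 2. There is a constant $C$ such that for every finite graph $G=(V,E)$ and every $X\subseteq V$ with $|X|\ge d\cdot|V|$, the number of minimal dominating sets of $G$ that are subsets of $X$ is at most $C\cdot(2-\varepsilon_d)^{|X|}$. -/

import Mathlib

/-! ### Dominating sets -/

/-- `S` is a dominating set of `G`: every vertex lies in the closed neighbourhood of a vertex
of `S`. -/
def IsDominatingSet {V : Type*} (G : SimpleGraph V) (S : Finset V) : Prop :=
  ∀ v, ∃ w ∈ S, w = v ∨ G.Adj w v

/-- `S` is an inclusion-minimal dominating set of the whole graph `G`, and `S ⊆ X`. -/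
def IsMinDomIn {V : Type*} (G : SimpleGraph V) (X S : Finset V) : Prop :=
  Minimal (IsDominatingSet G) S ∧ S ⊆ X

/-! ### Search trees -/

/-- The search tree of a branching computation. A `step` is one deterministic elementary step,
a `fork` is one binary branching step, and a `leaf` carries the final state of a branch. -/
inductive SearchTree (σ : Type) : Type where
  | leaf (s : σ) : SearchTree σ
  | step (t : SearchTree σ) : SearchTree σ
  | fork (l r : SearchTree σ) : SearchTree σ

namespace SearchTree

/-- The final states of all branches, from left to right. -/
def leaves {σ : Type} : SearchTree σ → List σ
  | leaf s => [s]
  | step t => t.leaves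
  | fork l r => l.leaves ++ r.leaves

/-- Continue the computation at every leaf; the continuation sees the state at this leaf only. -/
def bind {σ : Type} : SearchTree σ → (σ → SearchTree σ) → SearchTree σ
  | leaf s, k => k s
  | step t, k => step (t.bind k)
  | fork l r, k => fork (l.bind k) (r.bind k)

/-- The number of nodes of the tree: the total time spent on all branches together. -/
def size {σ : Type} : SearchTree σ → ℕ
  | leaf _ => 1
  | step t => t.size + 1
  | fork l r => l.size + r.size + 1

/-- The maximal number of steps on a path from the root to a leaf. -/
def height {σ : Type} : SearchTree σ → ℕ
  | leaf _ => 0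
  | step t => t.height + 1
  | fork l r => max l.height r.height + 1

end SearchTree

/-! ### Branching random access programs

A program of a unit-cost random access machine. It uses finitely many registers and finitely many
two-dimensional arrays, all of them with entries in `ℕ`; arithmetic is addition and (truncated)
subtraction, but not multiplication, so that one step of a fixed program touches a bounded number
of cells and lengthens the binary representation of the largest number in the memory by a bounded
number of bits. The only non-standard command is `branch`, which splits the computation into two
branches. Each of them continues with its own copy of the memory, so that the exploration of one
root-to-leaf path is independent of the other paths. -/

/-- The memory of the machine: register `x` holds `reg x`, and entry `(i, j)` of array `a` holds
`arr a i j`. -/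
structure Store : Type where
  reg : ℕ → ℕ
  arr : ℕ → ℕ → ℕ → ℕ

/-- Arithmetic expressions. Array names are constants of the program, array indices are computed. -/
inductive Expr : Type where
  | lit (c : ℕ) : Expr
  | reg (x : ℕ) : Expr
  | get (a : ℕ) (i j : Expr) : Expr
  | add (e f : Expr) : Expr
  | sub (e f : Expr) : Expr

/-- The value of an expression. -/
def Expr.eval (s : Store) : Expr → ℕ
  | lit c => c
  | reg x => s.reg x
  | get a i j => s.arr a (i.eval s) (j.eval s)
  | add e f => e.eval s + f.eval s
  | sub e f => e.eval s - f.eval s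

/-- Write `v` into register `x`. -/
def Store.setReg (s : Store) (x v : ℕ) : Store where
  reg := fun y => if y = x then v else s.reg y
  arr := s.arr

/-- Write `v` into entry `(i, j)` of array `a`. -/
def Store.setArr (s : Store) (a i j v : ℕ) : Store where
  reg := s.reg
  arr := fun b k l => if b = a ∧ k = i ∧ l = j then v else s.arr b k l

/-- Programs. A test succeeds when its expression has a nonzero value, and
`loop e p` repeats `p` while the test `e` succeeds. -/
inductive Program : Type where
  | skip : Program
  | assign (x : ℕ) (e : Expr) : Program
  | store (a : ℕ) (i j e : Expr) : Program
  | seq (p q : Program) : Program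
  | ite (e : Expr) (p q : Program) : Program
  | loop (e : Expr) (p : Program) : Program
  | branch (p q : Program) : Program

/-- `Exec p s t`: the program `p`, started in the state `s`, halts on every branch, and `t` is its
search tree. Every assignment, every test and every branching costs one step. -/
inductive Exec : Program → Store → SearchTree Store → Prop where
  | skip (s : Store) : Exec Program.skip s (.step (.leaf s))
  | assign (s : Store) (x : ℕ) (e : Expr) :
      Exec (.assign x e) s (.step (.leaf (s.setReg x (e.eval s))))
  | store (s : Store) (a : ℕ) (i j e : Expr) :
      Exec (.store a i j e) s (.step (.leaf (s.setArr a (i.eval s) (j.eval s) (e.eval s))))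
  | seq (p q : Program) (s : Store) (t : SearchTree Store) (k : Store → SearchTree Store) :
      Exec p s t → (∀ s' ∈ t.leaves, Exec q s' (k s')) → Exec (.seq p q) s (t.bind k)
  | iteTrue (e : Expr) (p q : Program) (s : Store) (t : SearchTree Store) :
      e.eval s ≠ 0 → Exec p s t → Exec (.ite e p q) s (.step t)
  | iteFalse (e : Expr) (p q : Program) (s : Store) (t : SearchTree Store) :
      e.eval s = 0 → Exec q s t → Exec (.ite e p q) s (.step t)
  | loopTrue (e : Expr) (p : Program) (s : Store) (t : SearchTree Store)
      (k : Store → SearchTree Store) :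
      e.eval s ≠ 0 → Exec p s t → (∀ s' ∈ t.leaves, Exec (.loop e p) s' (k s')) →
      Exec (.loop e p) s (.step (t.bind k))
  | loopFalse (e : Expr) (p : Program) (s : Store) :
      e.eval s = 0 → Exec (.loop e p) s (.step (.leaf s))
  | branch (p q : Program) (s : Store) (t u : SearchTree Store) :
      Exec p s t → Exec q s u → Exec (.branch p q) s (.fork t u)

theorem SearchTree.bind_congr {σ : Type} {t : SearchTree σ} {k l : σ → SearchTree σ}
    (h : ∀ s ∈ t.leaves, k s = l s) : t.bind k = t.bind l := by
  induction t with
  | leaf s => exact h s (by simp [leaves])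
  | step t ih => simp only [bind]; rw [ih h]
  | fork a b iha ihb =>
    simp only [bind]
    rw [iha fun s hs => h s (by simp [leaves, hs]), ihb fun s hs => h s (by simp [leaves, hs])]

/-- The search tree is determined by the program and the initial state. -/
theorem Exec.unique {p : Program} {s : Store} {t u : SearchTree Store}
    (ht : Exec p s t) (hu : Exec p s u) : t = u := by
  induction ht generalizing u with
  | skip | assign | store => cases hu; rfl
  | seq p q s t k _ _ iht ihk =>
    cases hu with
    | seq _ _ _ t' k' h1 h2 =>
      obtain rfl := iht h1
      exact SearchTree.bind_congr fun s' hs' => ihk s' hs' (h2 s' hs')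
  | iteTrue e p q s t he _ ih =>
    cases hu with
    | iteTrue _ _ _ _ _ _ h => rw [ih h]
    | iteFalse _ _ _ _ _ h0 => exact absurd h0 he
  | iteFalse e p q s t he _ ih =>
    cases hu with
    | iteTrue _ _ _ _ _ h0 => exact absurd he h0
    | iteFalse _ _ _ _ _ _ h => rw [ih h]
  | loopTrue e p s t k he _ _ iht ihk =>
    cases hu with
    | loopTrue _ _ _ t' k' _ h1 h2 =>
      obtain rfl := iht h1
      rw [SearchTree.bind_congr fun s' hs' => ihk s' hs' (h2 s' hs')]
    | loopFalse _ _ _ h0 => exact absurd h0 he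
  | loopFalse e p s he =>
    cases hu with
    | loopTrue _ _ _ _ _ h0 => exact absurd he h0
    | loopFalse => rfl
  | branch p q s t u _ _ iht ihu =>
    cases hu with
    | branch _ _ _ t' u' h1 h2 => rw [iht h1, ihu h2]

/-! ### Input and output -/

open Classical in
/-- The input `(G, X)`, where `G` has vertices `0, …, n - 1`: register `0` holds `n`, array `0`
holds the adjacency matrix of `G`, column `0` of array `1` holds the indicator vector of `X`, and
all other cells hold `0`. -/
noncomputable def inputStore {n : ℕ} (G : SimpleGraph (Fin n)) (X : Finset (Fin n)) : Store where
  reg := fun x => if x = 0 then n else 0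
  arr := fun a i j =>
    if a = 0 then (if ∃ u v : Fin n, (u : ℕ) = i ∧ (v : ℕ) = j ∧ G.Adj u v then 1 else 0)
    else if a = 1 then (if j = 0 ∧ ∃ v ∈ X, (v : ℕ) = i then 1 else 0)
    else 0

/-- What a branch outputs when it ends in the state `s`: nothing if register `1` holds `0`, and
otherwise the set of vertices whose indicator vector is in column `0` of array `2`. -/
def branchOutput (n : ℕ) (s : Store) : Option (Finset (Fin n)) :=
  if s.reg 1 = 0 then none else some (Finset.univ.filter fun v : Fin n => s.arr 2 v 0 ≠ 0)

/-- The list of all sets output by the branches of a search tree. -/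
def outputs (n : ℕ) (t : SearchTree Store) : List (Finset (Fin n)) :=
  t.leaves.filterMap (branchOutput n)

/-- `t` is the search tree of `A` on input `(G, X)`, and its branches output every minimal
dominating set of `G` that is a subset of `X` exactly once, and nothing else. -/
def EnumeratesMinDomIn (A : Program) {n : ℕ} (G : SimpleGraph (Fin n)) (X : Finset (Fin n))
    (t : SearchTree Store) : Prop :=
  Exec A (inputStore G X) t ∧ (outputs n t).Nodup ∧ ∀ S, S ∈ outputs n t ↔ IsMinDomIn G X S

/-! ### The search, combinatorially -/

section Search

variable {V : Type*} (G : SimpleGraph V)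

/-! Keep a set `S` of selected vertices and a set `U ⊆ X` of undecided ones, and branch on some `x ∈
U`: select it or discard it. Every minimal dominating set inside `X` occurs at a leaf
(`Search.mem_of_minimal`), and distinct leaves carry distinct sets (`Search.nodup`). Testing
minimality at the leaves gives the enumeration, and since paths have polynomial length, both parts
reduce to bounding the number of leaves.

Let `|V| ≤ q|X|`. If some undominated vertex has at most `64q` candidates, branching on the
candidates of one with the fewest saves something, because discarding all of them ends the branch;
`weight` spreads this saving over the successive branchings (`one_add_weight_le`). Otherwise the
branching vertex has the largest gain. If this is at least `4q`, selecting it lowers the potential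
`μ ^ |undominated|` by a constant factor, and the initial potential is affordable because `|V| ≤
q|X|`. If all gains are below `4q`, double counting leaves at most `|U|/16` undominated vertices
(`few_of_no_pivot`), and a crude bound settles the whole subtree (`Search.length_le_of_few`).
`Search.length_le_weight` combines the three cases and `Search.length_le` fixes the constants.

`Search` is a relation, so the bounds hold for every way of breaking ties. In particular they apply
to the choices of the machine (`searchLoop_halts`), and the counting statement needs no machine at
all. -/

/-- `w` lies in the closed neighbourhood of `v`. -/
def ClosedAdj (w v : V) : Prop := w = v ∨ G.Adj w v

theorem ClosedAdj.comm {w v : V} : ClosedAdj G w v ↔ ClosedAdj G v w := by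
  simp [ClosedAdj, G.adj_comm, eq_comm]

open Classical in
/-- The number of candidates in `U` that dominate `v`. -/
noncomputable def candidates (U : Finset V) (v : V) : ℕ :=
  (U.filter fun x => ClosedAdj G x v).card

open Classical in
theorem candidates_erase {G : SimpleGraph V} {U : Finset V} {x v : V} (hx : x ∈ U)
    (hxv : ClosedAdj G x v) :
    candidates G (U.erase x) v + 1 = candidates G U v := by
  rw [candidates, candidates, Finset.filter_erase, Finset.card_erase_add_one]
  simp [hx, hxv]

variable [Fintype V]

open Classical in
/-- The vertices that are not dominated by `S`. -/
noncomputable def undominated (S : Finset V) : Finset V :=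
  Finset.univ.filter fun v => ∀ w ∈ S, ¬ ClosedAdj G w v

open Classical in
/-- The number of vertices that become dominated when `x` joins `S`. -/
noncomputable def gain (S : Finset V) (x : V) : ℕ :=
  ((undominated G S).filter fun v => ClosedAdj G x v).card

/-- The search stops: everything is dominated, or some vertex can no longer be dominated. -/
def Stuck (S U : Finset V) : Prop :=
  undominated G S = ∅ ∨ ∃ v ∈ undominated G S, candidates G U v = 0

/-- `x` is an admissible branching vertex: it dominates a vertex with the fewest candidates, if
these are at most `k`, and otherwise it has the largest gain. -/
def IsPivot (k : ℕ) (S U : Finset V) (x : V) : Prop :=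
  x ∈ U ∧ 1 ≤ gain G S x ∧
    ((∃ v ∈ undominated G S, ClosedAdj G x v ∧ candidates G U v ≤ k ∧
        ∀ w ∈ undominated G S, candidates G U v ≤ candidates G U w) ∨
      ((∀ w ∈ undominated G S, k < candidates G U w) ∧ ∀ y ∈ U, gain G S y ≤ gain G S x))

open Classical in
/-- `Search G k S U l`: branching on the vertices of `U`, when those of `S` have been selected,
may lead to the list `l` of sets. -/
inductive Search (k : ℕ) : Finset V → Finset V → List (Finset V) → Prop
  | finish (S U : Finset V) : Stuck G S U → Search k S U [S]
  | split (S U : Finset V) (x : V) (l r : List (Finset V)) : IsPivot G k S U x →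
      Search k (insert x S) (U.erase x) l → Search k S (U.erase x) r → Search k S U (l ++ r)

variable {G}

/-! ### Existence, completeness and non-repetition of the search -/

theorem mem_undominated {S : Finset V} {v : V} :
    v ∈ undominated G S ↔ ∀ w ∈ S, ¬ ClosedAdj G w v := by
  simp [undominated]

theorem isDominatingSet_iff_undominated {S : Finset V} :
    IsDominatingSet G S ↔ undominated G S = ∅ := by
  simp [Finset.eq_empty_iff_forall_notMem, mem_undominated, IsDominatingSet, ← ClosedAdj.eq_1]

theorem exists_isPivot (k : ℕ) {S U : Finset V} (h : ¬ Stuck G S U) :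
    ∃ x, IsPivot G k S U x := by
  classical
  simp only [Stuck, not_or, not_exists, not_and] at h
  obtain ⟨h1, h2⟩ := h
  obtain ⟨v, hv, hmin⟩ := Finset.exists_min_image _ (candidates G U)
    (Finset.nonempty_iff_ne_empty.2 h1)
  obtain ⟨x, hx⟩ := Finset.card_pos.1 (Nat.pos_of_ne_zero (h2 v hv))
  simp only [Finset.mem_filter] at hx
  have hgain : 1 ≤ gain G S x := Finset.card_pos.2 ⟨v, by simp [hv, hx.2]⟩
  by_cases hk : candidates G U v ≤ k
  · exact ⟨x, hx.1, hgain, Or.inl ⟨v, hv, hx.2, hk, hmin⟩⟩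
  · obtain ⟨y, hy, hmax⟩ := Finset.exists_max_image U (gain G S) ⟨x, hx.1⟩
    exact ⟨y, hy, hgain.trans (hmax x hx.1),
      Or.inr ⟨fun w hw => (not_le.1 hk).trans_le (hmin w hw), hmax⟩⟩

/-- Each branching shrinks `U`. This serves the counting statement, where the vertex type is
arbitrary and no program is run. -/
theorem exists_search (k : ℕ) (S U : Finset V) : ∃ l, Search G k S U l := by
  classical
  induction hn : U.card generalizing S U with
  | zero =>
    by_cases h : Stuck G S U
    · exact ⟨_, .finish _ _ h⟩
    · obtain ⟨x, hx⟩ := exists_isPivot k h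
      simp [Finset.card_eq_zero.1 hn, IsPivot] at hx
  | succ m ih =>
    by_cases h : Stuck G S U
    · exact ⟨_, .finish _ _ h⟩
    · obtain ⟨x, hx⟩ := exists_isPivot k h
      have hc : (U.erase x).card = m := by rw [Finset.card_erase_of_mem hx.1, hn]; rfl
      obtain ⟨l, hl⟩ := ih (insert x S) _ hc
      obtain ⟨r, hr⟩ := ih S _ hc
      exact ⟨_, .split _ _ _ _ _ hx hl hr⟩

theorem Search.bounds {k : ℕ} {S U : Finset V} {l : List (Finset V)} (h : Search G k S U l) :
    ∀ T ∈ l, S ⊆ T ∧ ∀ y ∈ T, y ∈ S ∨ y ∈ U := by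
  classical
  induction h with
  | finish S U => simp +contextual
  | split S U x l r hx _ _ ihl ihr =>
    intro T hT
    rcases List.mem_append.1 hT with hT | hT
    · obtain ⟨h1, h2⟩ := ihl T hT
      refine ⟨(Finset.subset_insert _ _).trans h1, fun y hy => ?_⟩
      have := hx.1
      have := h2 y hy
      simp only [Finset.mem_insert, Finset.mem_erase] at this
      grind
    · obtain ⟨h1, h2⟩ := ihr T hT
      exact ⟨h1, fun y hy => (h2 y hy).imp_right Finset.mem_of_mem_erase⟩

/-- The sets of the left branch contain the branching vertex, those of the right branch avoid it. -/
theorem Search.nodup {k : ℕ} {S U : Finset V} {l : List (Finset V)} (h : Search G k S U l)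
    (hd : Disjoint S U) : l.Nodup := by
  classical
  induction h with
  | finish S U => simp
  | split S U x l r hx hl hr ihl ihr =>
    have hxS : x ∉ S := fun h => Finset.disjoint_left.1 hd h hx.1
    refine List.Nodup.append (ihl ?_) (ihr ?_) ?_
    · rw [Finset.disjoint_insert_left]
      exact ⟨by simp, hd.mono_right (Finset.erase_subset _ _)⟩
    · exact hd.mono_right (Finset.erase_subset _ _)
    · intro T h1 h2
      have h1 := (hl.bounds T h1).1 (Finset.mem_insert_self x S)
      have h2 := (hr.bounds T h2).2 x h1
      simp [hxS] at h2

/-- Follow the branches that agree with `T`. At the leaf, either `S ⊆ T` already dominates and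
minimality forces `T = S`, or some vertex has no dominator in `S ∪ U ⊇ T`, which is impossible. -/
theorem Search.mem_of_minimal {k : ℕ} {S U : Finset V} {l : List (Finset V)}
    (h : Search G k S U l) {T : Finset V} (hT : Minimal (IsDominatingSet G) T) (hS : S ⊆ T)
    (hU : ∀ y ∈ T, y ∈ S ∨ y ∈ U) : T ∈ l := by
  classical
  induction h with
  | finish S U h =>
    rcases h with h | ⟨v, hv, hc⟩
    · simpa using (hT.2 (isDominatingSet_iff_undominated.2 h) hS).antisymm hS
    · obtain ⟨w, hw, hwv⟩ := hT.1 v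
      rcases hU w hw with h | h
      · exact absurd hwv (mem_undominated.1 hv w h)
      · rw [candidates, Finset.card_eq_zero] at hc
        have : w ∈ U.filter fun x => ClosedAdj G x v := by
          simp only [Finset.mem_filter]; exact ⟨h, hwv⟩
        simp [hc] at this
  | split S U x l r hx _ _ ihl ihr =>
    rw [List.mem_append]
    by_cases hxT : x ∈ T
    · refine Or.inl (ihl (by simp [Finset.insert_subset_iff, hxT, hS]) ?_)
      intro y hy
      have := hU y hy
      simp only [Finset.mem_insert, Finset.mem_erase] at this ⊢
      tauto
    · refine Or.inr (ihr hS fun y hy => ?_)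
      have := hU y hy
      simp only [Finset.mem_erase] at this ⊢
      grind

/-! ### Bounding the number of leaves -/

open Classical in
theorem card_undominated_insert (S : Finset V) (x : V) :
    (undominated G (insert x S)).card + gain G S x = (undominated G S).card := by
  rw [gain, ← Finset.card_filter_add_card_filter_not (s := undominated G S)
    (fun v => ClosedAdj G x v), add_comm]
  congr 2
  ext v
  simp [mem_undominated, and_comm]

theorem sum_candidates (S U : Finset V) :
    ∑ v ∈ undominated G S, candidates G U v = ∑ x ∈ U, gain G S x := by
  classical
  simp only [candidates, gain, Finset.card_filter]
  exact Finset.sum_comm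

open Classical in
/-- The number of sets is small when few vertices are undominated. -/
theorem Search.length_le_of_few {k : ℕ} {S U : Finset V} {l : List (Finset V)}
    (h : Search G k S U l) :
    (l.length : ℝ) ≤ (3 / 2) ^ U.card * 2 ^ (undominated G S).card := by
  induction h with
  | finish S U =>
    have h1 : (1 : ℝ) ≤ (3 / 2) ^ U.card := one_le_pow₀ (by norm_num)
    have h2 : (1 : ℝ) ≤ 2 ^ (undominated G S).card := one_le_pow₀ (by norm_num)
    simpa using one_le_mul_of_one_le_of_one_le h1 h2
  | split S U x l r hx _ _ ihl ihr =>
    have hm := card_undominated_insert (G := G) S x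
    have hU : U.card = (U.erase x).card + 1 := (Finset.card_erase_add_one hx.1).symm
    -- A pivot dominates at least one new vertex, so selecting it halves the second factor; `1/2 + 1
    -- = 3/2` pays for both branches.
    have h2 : (2 : ℝ) ^ (undominated G (insert x S)).card * 2 ≤ 2 ^ (undominated G S).card := by
      rw [← pow_succ]
      exact pow_le_pow_right₀ (by norm_num) (by have := hx.2.1; omega)
    rw [hU, List.length_append, Nat.cast_add]
    have h0 : (0 : ℝ) ≤ (3 / 2) ^ (U.erase x).card := by positivity
    have h3 := mul_le_mul_of_nonneg_left h2 h0
    calc _ ≤ _ := add_le_add ihl ihr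
      _ ≤ _ := by rw [pow_succ]; linarith

/-- The weight of a vertex with `j` candidates. -/
noncomputable def weight (γ : ℝ) (k j : ℕ) : ℝ := 1 - γ * (2 ^ (k - j) - 1)

theorem weight_le_one {γ : ℝ} (hγ : 0 ≤ γ) (k j : ℕ) : weight γ k j ≤ 1 := by
  have : (1 : ℝ) ≤ 2 ^ (k - j) := one_le_pow₀ (by norm_num)
  have := mul_nonneg hγ (sub_nonneg.2 this)
  rw [weight]; linarith

theorem weight_mono {γ : ℝ} (hγ : 0 ≤ γ) (k : ℕ) {i j : ℕ} (h : i ≤ j) :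
    weight γ k i ≤ weight γ k j := by
  have : (2 : ℝ) ^ (k - j) ≤ 2 ^ (k - i) := pow_le_pow_right₀ (by norm_num) (by omega)
  have := mul_le_mul_of_nonneg_left this hγ
  simp only [weight]; linarith

/-- The weight is smallest at `j = 0`. This lower bound lets a leaf with an undominatable vertex pay
its cost `γ`. -/
theorem le_weight {γ : ℝ} (hγ : 0 ≤ γ) {k : ℕ} (h : γ * 2 ^ k ≤ 1) (j : ℕ) :
    γ ≤ weight γ k j := by
  have h1 := weight_mono hγ k (Nat.zero_le j)
  have h2 : weight γ k 0 = 1 - γ * 2 ^ k + γ := by simp only [weight, Nat.sub_zero]; ring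
  linarith

/-- The recurrence that dictates `weight`: selecting a candidate of `v` costs 1, discarding it
leaves `v` with one candidate fewer. With `y = 2 ^ (k - (j + 1))` the two sides differ by `γ² (y -
1)`. -/
theorem one_add_weight_le {γ : ℝ} (hγ : 0 ≤ γ) {k j : ℕ} (hj : j + 1 ≤ k) :
    1 + weight γ k j ≤ (2 - γ) * weight γ k (j + 1) := by
  have h : k - j = k - (j + 1) + 1 := by omega
  have h1 : (1 : ℝ) ≤ 2 ^ (k - (j + 1)) := one_le_pow₀ (by norm_num)
  simp only [weight]
  rw [h, pow_succ]
  nlinarith [mul_nonneg (mul_nonneg hγ hγ) (sub_nonneg.2 h1)]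

/-- Count the pairs of an undominated vertex and one of its candidates in both ways. -/
theorem few_of_no_pivot {q : ℕ} {S U : Finset V}
    (hc : ∀ w ∈ undominated G S, 64 * q < candidates G U w) (hg : ∀ y ∈ U, gain G S y ≤ 4 * q)
    (hq : 1 ≤ q) : 16 * (undominated G S).card ≤ U.card := by
  have h1 : (undominated G S).card * (64 * q) ≤ U.card * (4 * q) := by
    calc _ ≤ ∑ v ∈ undominated G S, candidates G U v := by
          simpa using Finset.card_nsmul_le_sum _ _ (64 * q) fun w hw => (hc w hw).le
      _ = ∑ x ∈ U, gain G S x := sum_candidates S U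
      _ ≤ _ := by simpa using Finset.sum_le_card_nsmul _ _ (4 * q) hg
  have : 4 * q * (16 * (undominated G S).card) ≤ 4 * q * U.card := by linarith
  exact Nat.le_of_mul_le_mul_left this (by omega)

theorem few_bound {a m : ℕ} (h : 16 * m ≤ a) :
    ((3 / 2 : ℝ) ^ a * 2 ^ m) ≤ (7 / 4) ^ a := by
  have h1 : (2 : ℝ) ^ m ≤ (7 / 6) ^ a := by
    calc (2 : ℝ) ^ m ≤ ((7 / 6) ^ 16) ^ m := pow_le_pow_left₀ (by norm_num) (by norm_num) m
      _ = (7 / 6) ^ (16 * m) := (pow_mul _ _ _).symm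
      _ ≤ _ := pow_le_pow_right₀ (by norm_num) h
  calc _ ≤ (3 / 2 : ℝ) ^ a * (7 / 6) ^ a := by gcongr
    _ = _ := by rw [← mul_pow]; norm_num

open Classical in
/-- The main estimate for the number of sets. -/
theorem Search.length_le_weight {q : ℕ} (hq : 1 ≤ q) {γ μ : ℝ} (hγ : 0 < γ)
    (hγk : γ * 2 ^ (64 * q) ≤ 1) (hγ4 : γ ≤ 1 / 4) (hμ : 1 ≤ μ)
    (hμq : 1 ≤ (1 - γ) * μ ^ (4 * q)) {S U : Finset V} {l : List (Finset V)}
    (h : Search G (64 * q) S U l) :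
    γ * l.length ≤ (2 - γ) ^ U.card * μ ^ (undominated G S).card ∧
      ∀ v ∈ undominated G S, γ * l.length ≤
        (2 - γ) ^ U.card * μ ^ (undominated G S).card * weight γ (64 * q) (candidates G U v) := by
  have hβ : (1 : ℝ) ≤ 2 - γ := by linarith
  have hpos : ∀ a b : ℕ, 1 ≤ (2 - γ) ^ a * μ ^ b := fun a b =>
    one_le_mul_of_one_le_of_one_le (one_le_pow₀ hβ) (one_le_pow₀ hμ)
  induction h with
  | finish S U =>
    have hp := hpos U.card (undominated G S).card
    refine ⟨by simpa using (by linarith : γ ≤ _), fun v _ => ?_⟩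
    have hw := le_weight hγ.le hγk (candidates G U v)
    have := mul_le_mul hp hw hγ.le (by linarith)
    simpa using this
  | split S U x l r hx hl hr ihl ihr =>
    have hm := card_undominated_insert (G := G) S x
    have hU : U.card = (U.erase x).card + 1 := (Finset.card_erase_add_one hx.1).symm
    have hsearch := Search.split S U x l r hx hl hr
    set a := (U.erase x).card
    set m := (undominated G S).card
    set m' := (undominated G (insert x S)).card
    have hpa : (0 : ℝ) ≤ (2 - γ) ^ a := by positivity
    have hpm := zero_le_one.trans (hpos a m)
    -- Selecting `x` dominates `v`, so no weight is inherited and only the unweighted bound is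
    -- available. It also covers the case where nothing stays undominated.
    have hl1 : γ * l.length ≤ (2 - γ) ^ a * μ ^ m :=
      ihl.1.trans (mul_le_mul_of_nonneg_left (pow_le_pow_right₀ hμ (by omega)) hpa)
    rw [hU, List.length_append, Nat.cast_add, mul_add, pow_succ]
    rcases hx.2.2 with ⟨v, hv, hxv, hvk, hvmin⟩ | ⟨hbig, hmax⟩
    · have key : γ * l.length + γ * r.length ≤
          (2 - γ) ^ a * (2 - γ) * μ ^ m * weight γ (64 * q) (candidates G U v) := by
        have hc := candidates_erase hx.1 hxv
        have h2 := ihr.2 v hv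
        have h3 := one_add_weight_le hγ.le (k := 64 * q)
          (j := candidates G (U.erase x) v) (by omega)
        rw [hc] at h3
        have := mul_le_mul_of_nonneg_left h3 hpm
        linarith
      have hq0 : 0 ≤ (2 - γ) ^ a * (2 - γ) * μ ^ m := by positivity
      refine ⟨key.trans (mul_le_of_le_one_right hq0 (weight_le_one hγ.le _ _)), fun w hw => ?_⟩
      -- Since `v` has the fewest candidates, its weight is the smallest.
      exact key.trans (mul_le_mul_of_nonneg_left (weight_mono hγ.le _ (hvmin w hw)) hq0)
    · have key : γ * l.length + γ * r.length ≤ (2 - γ) ^ a * (2 - γ) * μ ^ m := by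
        -- A large gain shrinks the left branch by the factor `1 - γ`, and `(1 - γ) + 1 = 2 - γ`.
        by_cases hg : 4 * q ≤ gain G S x
        · have h1 : μ ^ m' ≤ (1 - γ) * μ ^ m := by
            calc μ ^ m' ≤ μ ^ m' * ((1 - γ) * μ ^ (4 * q)) :=
                  le_mul_of_one_le_right (by positivity) hμq
              _ = (1 - γ) * μ ^ (m' + 4 * q) := by ring
              _ ≤ _ := mul_le_mul_of_nonneg_left
                  (pow_le_pow_right₀ hμ (by omega)) (by linarith)
          have h2 := ihl.1.trans (mul_le_mul_of_nonneg_left h1 hpa)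
          have h3 := ihr.1
          linarith
        -- Here the induction hypotheses are dropped: the whole subtree has at most `(7/4) ^ |U|`
        -- leaves, and `7/4 ≤ 2 - γ`.
        · have h16 := few_of_no_pivot hbig (fun y hy => (hmax y hy).trans (not_le.1 hg).le) hq
          have h1 := hsearch.length_le_of_few.trans (few_bound h16)
          have h2 : (7 / 4 : ℝ) ^ U.card ≤ (2 - γ) ^ U.card :=
            pow_le_pow_left₀ (by norm_num) (by linarith) _
          have h3 : (1 : ℝ) ≤ μ ^ m := one_le_pow₀ hμ
          rw [List.length_append, Nat.cast_add] at h1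
          have h4 : (0 : ℝ) ≤ (l.length : ℝ) + r.length := by positivity
          calc γ * l.length + γ * r.length ≤ (l.length : ℝ) + r.length := by nlinarith
            _ ≤ (2 - γ) ^ U.card := h1.trans h2
            _ = (2 - γ) ^ a * (2 - γ) := by rw [hU, pow_succ]
            _ ≤ _ := le_mul_of_one_le_right (by positivity) h3
      refine ⟨key, fun w hw => ?_⟩
      -- Above the threshold the truncated exponent is 0.
      have : weight γ (64 * q) (candidates G U w) = 1 := by
        simp [weight, Nat.sub_eq_zero_of_le (hbig w hw).le]
      rwa [this, mul_one]

/-- The threshold `q` may depend on the input, while the base of the exponential depends only on the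
uniform bound `Q`. -/
theorem Search.length_le {q Q : ℕ} (hq : 1 ≤ q) (hqQ : q ≤ Q) {X : Finset V}
    (hX : Fintype.card V ≤ q * X.card) {l : List (Finset V)} (h : Search G (64 * q) ∅ X l) :
    (l.length : ℝ) ≤ 2 ^ (64 * Q) * (2 - (1 / 2) ^ (64 * Q) / 3) ^ X.card := by
  set γ : ℝ := (1 / 2) ^ (64 * Q) with hγdef
  have hγ : 0 < γ := by positivity
  have hγ2 : γ * 2 ^ (64 * Q) = 1 := by rw [hγdef, ← mul_pow]; norm_num
  have hγk : γ * 2 ^ (64 * q) ≤ 1 := by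
    rw [← hγ2]; gcongr; norm_num
  have hγ4 : γ ≤ 1 / 4 := by
    calc γ ≤ (1 / 2) ^ 2 := pow_le_pow_of_le_one (by norm_num) (by norm_num) (by omega)
      _ = _ := by norm_num
  -- With `μ ^ q = 1 + γ/3` the initial potential is at most `(1 + γ/3) ^ |X|`, and `(2 - γ)(1 +
  -- γ/3) ≤ 2 - γ/3`. Bernoulli and `γ ≤ 1/4` give `(1 - γ) μ ^ (4q) ≥ 1`.
  set μ : ℝ := (1 + γ / 3) ^ ((q : ℝ)⁻¹) with hμdef
  have hμq : μ ^ q = 1 + γ / 3 := Real.rpow_inv_natCast_pow (by positivity) (by omega)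
  have hμ : 1 ≤ μ := Real.one_le_rpow (by linarith) (by positivity)
  have hμ4 : 1 ≤ (1 - γ) * μ ^ (4 * q) := by
    rw [mul_comm 4, pow_mul, hμq]
    have : 1 + 4 * (γ / 3) ≤ (1 + γ / 3) ^ 4 := by
      have := one_add_mul_le_pow (a := γ / 3) (by linarith) 4
      simpa using this
    nlinarith
  have h1 := (h.length_le_weight hq hγ hγk hγ4 hμ hμ4).1
  have h2 : μ ^ (undominated G (∅ : Finset V)).card ≤ (1 + γ / 3) ^ X.card := by
    rw [← hμq, ← pow_mul]
    exact pow_le_pow_right₀ hμ ((Finset.card_le_univ _).trans hX)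
  have h3 : (2 - γ) ^ X.card * (1 + γ / 3) ^ X.card ≤ (2 - γ / 3) ^ X.card := by
    rw [← mul_pow]
    exact pow_le_pow_left₀ (mul_nonneg (by linarith) (by linarith)) (by nlinarith) _
  have h4 : γ * l.length ≤ (2 - γ / 3) ^ X.card :=
    h1.trans ((mul_le_mul_of_nonneg_left h2 (pow_nonneg (by linarith) _)).trans h3)
  calc (l.length : ℝ) = 2 ^ (64 * Q) * (γ * l.length) := by
        rw [← mul_assoc, mul_comm _ γ, hγ2, one_mul]
    _ ≤ _ := by gcongr

end Search

/-! ### Program logic -/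

namespace SearchTree

variable {σ : Type}

theorem leaves_bind (t : SearchTree σ) (k : σ → SearchTree σ) :
    (t.bind k).leaves = t.leaves.flatMap fun s => (k s).leaves := by
  induction t with
  | leaf s => simp [bind, leaves]
  | step t ih => simpa [bind, leaves] using ih
  | fork l r ihl ihr => simp [bind, leaves, ihl, ihr]

theorem height_bind_le {t : SearchTree σ} {k : σ → SearchTree σ} {H : ℕ}
    (h : ∀ s ∈ t.leaves, (k s).height ≤ H) : (t.bind k).height ≤ t.height + H := by
  induction t with
  | leaf s => simpa [bind, leaves, height] using h
  | step t ih => have := ih h; simp only [bind, height]; omega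
  | fork l r ihl ihr =>
    have h1 := ihl fun s hs => h s (by simp [leaves, hs])
    have h2 := ihr fun s hs => h s (by simp [leaves, hs])
    simp only [bind, height]; omega

/-- Every node lies on a path from the root to some leaf, and such a path has at most `height + 1`
nodes. -/
theorem size_le (t : SearchTree σ) : t.size ≤ t.leaves.length * (t.height + 1) := by
  have pos : ∀ t : SearchTree σ, 1 ≤ t.leaves.length := by
    intro t
    induction t with
    | leaf s => simp [leaves]
    | step t ih => simpa [leaves] using ih
    | fork l r ihl _ => simp only [leaves, List.length_append]; omega
  induction t with
  | leaf s => simp [size, leaves, height]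
  | step t ih => have := pos t; simp only [size, leaves, height]; nlinarith
  | fork l r ihl ihr =>
    have h1 := pos l
    have h2 := pos r
    simp only [size, leaves, height, List.length_append]
    have h3 := Nat.mul_le_mul_left l.leaves.length
      (Nat.add_le_add_right (le_max_left l.height r.height) 1)
    have h4 := Nat.mul_le_mul_left r.leaves.length
      (Nat.add_le_add_right (le_max_right l.height r.height) 1)
    nlinarith

end SearchTree

/-- The program `p`, started in `s`, makes at most `H` steps on every branch, and `ls` are the
final states of its branches. -/
def Halts (p : Program) (s : Store) (H : ℕ) (ls : List Store) : Prop :=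
  ∃ t, Exec p s t ∧ t.height ≤ H ∧ t.leaves = ls

namespace Halts

variable {p q : Program} {s : Store} {H H' : ℕ} {ls ls' : List Store} {e : Expr}

theorem mono (h : Halts p s H ls) (hH : H ≤ H') : Halts p s H' ls := by
  obtain ⟨t, h1, h2, h3⟩ := h
  exact ⟨t, h1, h2.trans hH, h3⟩

theorem skip (s : Store) : Halts .skip s 1 [s] :=
  ⟨_, .skip s, le_rfl, rfl⟩

theorem assign (s : Store) (x : ℕ) (e : Expr) :
    Halts (.assign x e) s 1 [s.setReg x (e.eval s)] :=
  ⟨_, .assign s x e, le_rfl, rfl⟩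

theorem store (s : Store) (a : ℕ) (i j e : Expr) :
    Halts (.store a i j e) s 1 [s.setArr a (i.eval s) (j.eval s) (e.eval s)] :=
  ⟨_, .store s a i j e, le_rfl, rfl⟩

theorem exists_bind {t : SearchTree Store} {K : Store → List Store}
    (h : ∀ s' ∈ t.leaves, Halts q s' H' (K s')) :
    ∃ k : Store → SearchTree Store, (∀ s' ∈ t.leaves, Exec q s' (k s')) ∧
      (t.bind k).height ≤ t.height + H' ∧ (t.bind k).leaves = t.leaves.flatMap K := by
  have : Nonempty (SearchTree Store) := ⟨.leaf ⟨fun _ => 0, fun _ _ _ => 0⟩⟩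
  choose! k hk using h
  refine ⟨k, fun s' hs' => (hk s' hs').1, t.height_bind_le fun s' hs' => (hk s' hs').2.1, ?_⟩
  rw [t.leaves_bind]
  exact List.flatMap_congr fun s' hs' => (hk s' hs').2.2

theorem seq {K : Store → List Store} (hp : Halts p s H ls)
    (hq : ∀ s' ∈ ls, Halts q s' H' (K s')) : Halts (.seq p q) s (H + H') (ls.flatMap K) := by
  obtain ⟨t, h1, h2, rfl⟩ := hp
  obtain ⟨k, h3, h4, h5⟩ := exists_bind hq
  exact ⟨_, .seq p q s t k h1 h3, by omega, h5⟩

theorem seq_single {s' : Store} (hp : Halts p s H [s']) (hq : Halts q s' H' ls) :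
    Halts (.seq p q) s (H + H') ls := by
  simpa using hp.seq (K := fun _ => ls) (by simpa using hq)

theorem ite_true (he : e.eval s ≠ 0) (hp : Halts p s H ls) :
    Halts (.ite e p q) s (H + 1) ls := by
  obtain ⟨t, h1, h2, rfl⟩ := hp
  exact ⟨_, .iteTrue e p q s t he h1, Nat.succ_le_succ h2, rfl⟩

theorem ite_false (he : e.eval s = 0) (hq : Halts q s H ls) :
    Halts (.ite e p q) s (H + 1) ls := by
  obtain ⟨t, h1, h2, rfl⟩ := hq
  exact ⟨_, .iteFalse e p q s t he h1, Nat.succ_le_succ h2, rfl⟩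

theorem branch (hp : Halts p s H ls) (hq : Halts q s H ls') :
    Halts (.branch p q) s (H + 1) (ls ++ ls') := by
  obtain ⟨t, h1, h2, rfl⟩ := hp
  obtain ⟨u, h3, h4, rfl⟩ := hq
  exact ⟨_, .branch p q s t u h1 h3, Nat.succ_le_succ (max_le h2 h4), rfl⟩

theorem loop_true {K : Store → List Store} (he : e.eval s ≠ 0) (hp : Halts p s H ls)
    (hq : ∀ s' ∈ ls, Halts (.loop e p) s' H' (K s')) :
    Halts (.loop e p) s (H + H' + 1) (ls.flatMap K) := by
  obtain ⟨t, h1, h2, rfl⟩ := hp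
  obtain ⟨k, h3, h4, h5⟩ := exists_bind hq
  exact ⟨_, .loopTrue e p s t k he h1 h3, by simp only [SearchTree.height]; omega, h5⟩

theorem loop_false (he : e.eval s = 0) : Halts (.loop e p) s 1 [s] :=
  ⟨_, .loopFalse e p s he, le_rfl, rfl⟩

end Halts

/-- Repeat `p` with register `r` running through `0, …, n - 1`, where `n` is in register `0`. -/
def forLoop (r : ℕ) (p : Program) : Program :=
  .seq (.assign r (.lit 0))
    (.loop (.sub (.reg 0) (.reg r)) (.seq p (.assign r (.add (.reg r) (.lit 1)))))

/-- `I i` is the invariant before round `i`. A round costs `T` plus a test and an increment; the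
last 2 counts the initial assignment and the failing test. -/
theorem forLoop_halts {r n T : ℕ} {p : Program} {s : Store} (I : ℕ → Store → Prop)
    (hn : ∀ i s, I i s → s.reg 0 = n ∧ s.reg r = i) (h0 : I 0 (s.setReg r 0))
    (hstep : ∀ i s, i < n → I i s →
      ∃ s', Halts p s T [s'] ∧ s'.reg r = i ∧ I (i + 1) (s'.setReg r (i + 1))) :
    ∃ s', Halts (forLoop r p) s (n * (T + 2) + 2) [s'] ∧ I n s' := by
  have key : ∀ m i s, i + m = n → I i s →
      ∃ s', Halts (.loop (.sub (.reg 0) (.reg r)) (.seq p (.assign r (.add (.reg r) (.lit 1)))))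
        s (m * (T + 2) + 1) [s'] ∧ I n s' := by
    intro m
    induction m with
    | zero =>
      intro i s hi hI
      obtain ⟨h1, h2⟩ := hn i s hI
      obtain rfl : i = n := by omega
      exact ⟨s, by simpa using Halts.loop_false (by simp [Expr.eval, h1, h2]), hI⟩
    | succ m ih =>
      intro i s hi hI
      obtain ⟨h1, h2⟩ := hn i s hI
      obtain ⟨s1, hs1, hr, hI1⟩ := hstep i s (by omega) hI
      obtain ⟨s2, hs2, hI2⟩ := ih (i + 1) _ (by omega) hI1
      refine ⟨s2, ?_, hI2⟩
      have h3 := hs1.seq_single (Halts.assign s1 r (.add (.reg r) (.lit 1)))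
      simp only [Expr.eval, hr] at h3
      have h4 := Halts.loop_true (e := .sub (.reg 0) (.reg r)) (K := fun _ => [s2])
        (by simp only [Expr.eval, h1, h2]; omega) h3 (by simpa using hs2)
      simp only [List.flatMap_cons, List.flatMap_nil, List.append_nil] at h4
      exact h4.mono (by rw [Nat.succ_mul]; omega)
  obtain ⟨s', h1, h2⟩ := key n 0 _ (by omega) h0
  refine ⟨s', ?_, h2⟩
  exact ((Halts.assign s r (.lit 0)).seq_single h1).mono (by omega)

/-! ### Program fragments -/

/-- Entry `i` of column `0` of array `a`. -/
def col (a : ℕ) (i : Expr) : Expr := .get a i (.lit 0)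

/-- The entry of the adjacency matrix at `(i, j)`, with ones on the diagonal. -/
def closedEntry (i j : Expr) : Expr :=
  .add (.get 0 i j) (.sub (.lit 1) (.add (.sub i j) (.sub j i)))

/-- Let entry `i` of column `0` of array `a` be the sum over `j` of the values of `e`, where `i` is
in register `10` and `j` is in register `11`. -/
def fill (a : ℕ) (e : Expr) : Program :=
  forLoop 10 (.seq (.store a (.reg 10) (.lit 0) (.lit 0))
    (forLoop 11 (.store a (.reg 10) (.lit 0) (.add (col a (.reg 10)) e))))

/-- Store the maximal value of `e` over all values of register `10` into register `12`, and the
first place where it is attained into register `13`. -/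
def argmax (e : Expr) : Program :=
  .seq (.assign 12 (.lit 0)) (.seq (.assign 13 (.lit 0)) (forLoop 10
    (.ite (.sub e (.reg 12)) (.seq (.assign 12 e) (.assign 13 (.reg 10))) .skip)))

/-- `s` and `s'` differ only in the two loop counters and in array `a`. -/
def FillFrame (a : ℕ) (s s' : Store) : Prop :=
  (∀ r, r ≠ 10 → r ≠ 11 → s'.reg r = s.reg r) ∧ ∀ b, b ≠ a → s'.arr b = s.arr b

/-- `s` and `s'` differ only in the registers used by `argmax`. -/
def ArgmaxFrame (s s' : Store) : Prop :=
  (∀ r, r ≠ 10 → r ≠ 12 → r ≠ 13 → s'.reg r = s.reg r) ∧ s'.arr = s.arr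

/-- The value of `e` must survive changes to the counters and to array `a`, since these change while
the sums are being built. -/
theorem fill_halts {a n : ℕ} {e : Expr} {s : Store} (f : ℕ → ℕ → ℕ) (hn : s.reg 0 = n)
    (he : ∀ s', FillFrame a s s' → s'.reg 10 < n → s'.reg 11 < n →
      e.eval s' = f (s'.reg 10) (s'.reg 11)) :
    ∃ s', Halts (fill a e) s (n * (3 * n + 5) + 2) [s'] ∧ FillFrame a s s' ∧
      ∀ k l, s'.arr a k l =
        if k < n ∧ l = 0 then ∑ j ∈ Finset.range n, f k j else s.arr a k l := by
  have := forLoop_halts (r := 10) (n := n) (T := 3 * n + 3) (s := s)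
    (p := .seq (.store a (.reg 10) (.lit 0) (.lit 0))
      (forLoop 11 (.store a (.reg 10) (.lit 0) (.add (col a (.reg 10)) e))))
    (fun i s' => s'.reg 10 = i ∧ FillFrame a s s' ∧ ∀ k l, s'.arr a k l =
        if k < i ∧ l = 0 then ∑ j ∈ Finset.range n, f k j else s.arr a k l)
    (fun i s' ⟨h1, h2, _⟩ => ⟨by rw [h2.1 0 (by simp) (by simp), hn], h1⟩)
    ⟨by simp [Store.setReg], ⟨by simp +contextual [Store.setReg], by simp [Store.setReg]⟩,
      by simp [Store.setReg]⟩ ?_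
  · obtain ⟨s', h1, _, h2, h3⟩ := this
    exact ⟨s', h1, h2, h3⟩
  · rintro i s1 hi ⟨h1, h2, h3⟩
    obtain ⟨s', h4, h5, _, h6, h7⟩ := forLoop_halts (r := 11) (n := n) (T := 1)
      (s := s1.setArr a i 0 0)
      (p := .store a (.reg 10) (.lit 0) (.add (col a (.reg 10)) e))
      (fun j s' => s'.reg 10 = i ∧ s'.reg 11 = j ∧ FillFrame a s s' ∧ ∀ k l, s'.arr a k l =
        if k = i ∧ l = 0 then ∑ j' ∈ Finset.range j, f k j' else s1.arr a k l)
      (fun j s' ⟨_, h1, h2, _⟩ => ⟨by rw [h2.1 0 (by simp) (by simp), hn], h1⟩)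
      ⟨by simp [Store.setReg, Store.setArr, h1], by simp [Store.setReg],
        ⟨fun r hr hr' => by simp [Store.setReg, Store.setArr, hr', h2.1 r hr hr'],
          fun b hb => by simp [Store.setReg, Store.setArr, hb, h2.2 b hb]⟩,
        fun k l => by simp [Store.setReg, Store.setArr]⟩
      (by
        rintro j s2 hj ⟨g1, g2, g3, g4⟩
        refine ⟨_, Halts.store _ _ _ _ _, g2, g1, by simp [Store.setReg],
          ⟨fun r hr hr' => by simp [Store.setReg, Store.setArr, hr', g3.1 r hr hr'],
          fun b hb => by simp [Store.setReg, Store.setArr, hb, g3.2 b hb]⟩, fun k l => ?_⟩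
        have hv := he s2 g3 (by omega) (by omega)
        simp only [Store.setReg, Store.setArr, Expr.eval, col, g1, hv, g2, g4, true_and,
          Finset.sum_range_succ]
        by_cases hk : k = i ∧ l = 0
        · obtain ⟨rfl, rfl⟩ := hk; simp
        · simp [hk])
    refine ⟨s', ?_, h5, by simp [Store.setReg],
      ⟨fun r hr hr' => by simp [Store.setReg, hr, h6.1 r hr hr'], h6.2⟩, fun k l => ?_⟩
    · have := (Halts.store s1 a (.reg 10) (.lit 0) (.lit 0)).seq_single
        (by simpa [Expr.eval, h1] using h4)
      exact this.mono (by omega)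
    · simp only [Store.setReg, h7, h3]
      by_cases hk : k = i
      · subst hk; by_cases hl : l = 0 <;> simp [hl]
      · have : k < i + 1 ↔ k < i := by omega
        simp [hk, this]

theorem argmax_halts {n : ℕ} {e : Expr} {s : Store} (g : ℕ → ℕ) (hn : s.reg 0 = n)
    (he : ∀ s', ArgmaxFrame s s' → s'.reg 10 < n → e.eval s' = g (s'.reg 10)) :
    ∃ s', Halts (argmax e) s (n * 5 + 4) [s'] ∧ ArgmaxFrame s s' ∧
      (∀ i < n, g i ≤ s'.reg 12) ∧
      (s'.reg 12 ≠ 0 → s'.reg 13 < n ∧ g (s'.reg 13) = s'.reg 12) := by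
  have := forLoop_halts (r := 10) (n := n) (T := 3) (s := (s.setReg 12 0).setReg 13 0)
    (p := .ite (.sub e (.reg 12)) (.seq (.assign 12 e) (.assign 13 (.reg 10))) .skip)
    (fun i s' => s'.reg 10 = i ∧ ArgmaxFrame s s' ∧ (∀ k < i, g k ≤ s'.reg 12) ∧
      (s'.reg 12 ≠ 0 → s'.reg 13 < n ∧ g (s'.reg 13) = s'.reg 12))
    (fun i s' ⟨h1, h2, _⟩ => ⟨by rw [h2.1 0 (by simp) (by simp) (by simp), hn], h1⟩)
    ⟨by simp [Store.setReg], ⟨by simp +contextual [Store.setReg], by simp [Store.setReg]⟩,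
      by simp, by simp [Store.setReg]⟩ ?_
  · obtain ⟨s', h1, _, h2, h3, h4⟩ := this
    refine ⟨s', ?_, h2, h3, h4⟩
    exact ((Halts.assign _ _ _).seq_single ((Halts.assign _ _ _).seq_single h1)).mono (by omega)
  · rintro i s1 hi ⟨h1, h2, h3, h4⟩
    have hv := he s1 h2 (by omega)
    rw [h1] at hv
    by_cases hlt : s1.reg 12 < g i
    · refine ⟨_, Halts.ite_true ?_ ((Halts.assign _ _ _).seq_single (Halts.assign _ _ _)),
        by simp [Store.setReg, h1], by simp [Store.setReg],
        ⟨fun r hr hr' hr2 => by simp [Store.setReg, hr, hr', hr2, h2.1 r hr hr' hr2], h2.2⟩,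
        fun k hk => ?_, fun _ => ?_⟩
      · simp only [Expr.eval, hv]; omega
      · simp only [Store.setReg, hv, Nat.reduceEqDiff, ↓reduceIte]
        rcases Nat.lt_succ_iff_lt_or_eq.1 hk with hk | rfl
        · exact (h3 k hk).trans hlt.le
        · exact le_rfl
      · simpa [Store.setReg, Expr.eval, h1, hv] using hi
    · refine ⟨_, (Halts.ite_false ?_ (Halts.skip _)).mono (by omega), h1, by simp [Store.setReg],
        ⟨fun r hr hr' hr2 => by simp [Store.setReg, hr, h2.1 r hr hr' hr2], h2.2⟩,
        fun k hk => ?_, ?_⟩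
      · simp only [Expr.eval, hv]; omega
      · simp only [Store.setReg]
        rcases Nat.lt_succ_iff_lt_or_eq.1 hk with hk | rfl
        · exact h3 k hk
        · simpa using hlt
      · simpa [Store.setReg] using h4

/-! ### The algorithm -/

/-- Compute the number of neighbours in `S` for every vertex. -/
def countDominators : Program :=
  fill 3 (.sub (.add (closedEntry (.reg 10) (.reg 11)) (col 2 (.reg 11))) (.lit 1))

/-- Put an undominated vertex with the fewest candidates into register `3`; the flag in
register `2` tells whether there is one and it has candidates. -/
def selectVertex : Program :=
  .seq countDominators <|
  -- For 0/1 values, `a + b - 1` is conjunction. An undominated vertex receives its number of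
  -- non-candidates, a dominated one 0.
  .seq (fill 4 (.sub (.sub (.lit 1)
    (.sub (.add (closedEntry (.reg 10) (.reg 11)) (col 1 (.reg 11))) (.lit 1)))
    (col 3 (.reg 10)))) <|
  .seq (argmax (.add (col 4 (.reg 10)) (.sub (.lit 1) (col 3 (.reg 10))))) <|
  -- The maximum is 0 if all is dominated, and otherwise `n + 1` minus the fewest candidates. The
  -- flag says that it lies strictly between 0 and `n + 1`.
  .seq (.assign 2 (.sub (.lit 1) (.add (.sub (.lit 1) (.reg 12))
    (.sub (.lit 1) (.sub (.add (.reg 0) (.lit 1)) (.reg 12))))))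
  (.assign 3 (.reg 13))

/-- Put the branching vertex into register `5`. -/
def selectCandidate : Program :=
  -- The test says that the fewest candidates number at most the threshold in register `4`.
  .seq (.ite (.sub (.add (.reg 4) (.lit 1)) (.sub (.add (.reg 0) (.lit 1)) (.reg 12)))
    (argmax (.sub (.add (closedEntry (.reg 10) (.reg 3)) (col 1 (.reg 10))) (.lit 1)))
    (.seq (fill 5 (.sub (.sub (.add (closedEntry (.reg 10) (.reg 11)) (col 1 (.reg 10))) (.lit 1))
      (col 3 (.reg 11)))) (argmax (col 5 (.reg 10)))))
  (.assign 5 (.reg 13))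

/-- One round of the search. -/
def searchRound : Program :=
  .seq (.seq selectVertex selectCandidate) (.ite (.reg 2)
    (.seq (.store 1 (.reg 5) (.lit 0) (.lit 0))
      (.branch (.store 2 (.reg 5) (.lit 0) (.lit 1)) .skip)) .skip)

/-- Set the output flag if the selected set is a minimal dominating set. -/
def checkMinimal : Program :=
  .seq countDominators <|
  .seq (fill 4 (.sub (closedEntry (.reg 10) (.reg 11)) (.sub (col 3 (.reg 11)) (.lit 1)))) <|
  .seq (argmax (.add (.sub (col 2 (.reg 10)) (col 4 (.reg 10)))
    (.sub (.lit 1) (col 3 (.reg 10))))) <|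
  .assign 1 (.sub (.lit 1) (.reg 12))

/-- Twice the value of an expression. -/
def double (e : Expr) : Expr := .add e e

/-- Compute the threshold for the number of candidates, and set the flag in register `2`. -/
def initializeSearch : Program :=
  .seq (fill 3 (col 1 (.reg 11))) <|
  -- Multiplication by addressing: the column index is 0, where `|X|` is stored, for `j < i`, and 1,
  -- where 0 is stored, otherwise. The sum over `j` is `i * |X|`.
  .seq (fill 4 (.get 3 (.lit 0) (.sub (.lit 1) (.sub (.reg 10) (.reg 11))))) <|
  .seq (fill 5 (.sub (.lit 1) (.sub (.lit 1) (.sub (.reg 0) (col 4 (.reg 11)))))) <|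
  .seq (.assign 4 (double (double (double (double (double (double
    (.add (col 5 (.lit 0)) (.lit 1))))))))) <|
  .assign 2 (.lit 1)

/-- The branching algorithm. -/
def enumerateMinDom : Program :=
  .seq initializeSearch (.seq (.loop (.reg 2) searchRound) checkMinimal)

/-! ### The machine carries out the combinatorial search -/

section Correctness

variable {n : ℕ} {G : SimpleGraph (Fin n)}

open Classical in
/-- The memory holds `G`, the selected vertices `S` and the undecided vertices `U`. -/
structure Encodes (G : SimpleGraph (Fin n)) (S U : Finset (Fin n)) (s : Store) : Prop where
  size : s.reg 0 = n
  adj : ∀ u v : Fin n, s.arr 0 u v = if G.Adj u v then 1 else 0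
  undecided : ∀ v : Fin n, s.arr 1 v 0 = if v ∈ U then 1 else 0
  selected : ∀ v : Fin n, s.arr 2 v 0 = if v ∈ S then 1 else 0

theorem Encodes.congr {S U : Finset (Fin n)} {s s' : Store} (h : Encodes G S U s)
    (hr : s'.reg 0 = s.reg 0) (h0 : s'.arr 0 = s.arr 0) (h1 : s'.arr 1 = s.arr 1)
    (h2 : s'.arr 2 = s.arr 2) : Encodes G S U s' :=
  ⟨by rw [hr, h.size], by simpa [h0] using h.adj, by simpa [h1] using h.undecided,
    by simpa [h2] using h.selected⟩

theorem Encodes.fillFrame {S U : Finset (Fin n)} {s s' : Store} {a : ℕ} (h : Encodes G S U s)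
    (hf : FillFrame a s s') (ha : 3 ≤ a) : Encodes G S U s' :=
  h.congr (hf.1 0 (by simp) (by simp)) (hf.2 0 (by omega)) (hf.2 1 (by omega))
    (hf.2 2 (by omega))

theorem Encodes.argmaxFrame {S U : Finset (Fin n)} {s s' : Store} (h : Encodes G S U s)
    (hf : ArgmaxFrame s s') : Encodes G S U s' :=
  h.congr (hf.1 0 (by simp) (by simp) (by simp)) (by rw [hf.2]) (by rw [hf.2]) (by rw [hf.2])

theorem Encodes.setReg {S U : Finset (Fin n)} {s : Store} (h : Encodes G S U s) {r : ℕ}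
    (hr : r ≠ 0) (v : ℕ) : Encodes G S U (s.setReg r v) :=
  h.congr (by simp [Store.setReg, hr.symm]) rfl rfl rfl

/-- The value of `closedEntry` at the indices `i` and `j`. -/
def closedValue (s : Store) (i j : ℕ) : ℕ := s.arr 0 i j + (1 - ((i - j) + (j - i)))

open Classical in
theorem Encodes.closedValue_eq {S U : Finset (Fin n)} {s : Store} (h : Encodes G S U s)
    (u v : Fin n) : closedValue s u v = if ClosedAdj G u v then 1 else 0 := by
  rw [closedValue, h.adj]
  by_cases huv : u = v
  · subst huv; simp [ClosedAdj]
  · have : (u : ℕ) ≠ v := fun h => huv (Fin.ext h)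
    have h1 : 1 - ((u : ℕ) - v + (v - u)) = 0 := by omega
    simp [ClosedAdj, huv, h1]

variable {S U : Finset (Fin n)} {s : Store}

theorem sum_range_eq_card {f : ℕ → ℕ} {A : Finset (Fin n)}
    (h : ∀ i : Fin n, f i = if i ∈ A then 1 else 0) : ∑ i ∈ Finset.range n, f i = A.card := by
  simp [Finset.sum_range, h]

open Classical in
theorem countDominators_halts (h : Encodes G S U s) :
    ∃ s', Halts countDominators s (n * (3 * n + 5) + 2) [s'] ∧ FillFrame 3 s s' ∧
      ∀ v : Fin n, s'.arr 3 v 0 = (S.filter fun w => ClosedAdj G w v).card := by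
  obtain ⟨s', h1, h2, h3⟩ := fill_halts (a := 3)
    (e := .sub (.add (closedEntry (.reg 10) (.reg 11)) (col 2 (.reg 11))) (.lit 1))
    (fun i j => closedValue s i j + s.arr 2 j 0 - 1) h.size
    (fun s' hf _ _ => by
      simp [Expr.eval, closedEntry, col, closedValue, hf.2 0 (by simp), hf.2 2 (by simp)])
  refine ⟨s', h1, h2, fun v => ?_⟩
  rw [h3, if_pos ⟨v.2, rfl⟩]
  refine sum_range_eq_card fun w => ?_
  rw [h.closedValue_eq, h.selected, ClosedAdj.comm]
  by_cases h1 : ClosedAdj G w v <;> by_cases h2 : w ∈ S <;> simp [h1, h2]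

open Classical in
theorem card_dominators_eq_zero {v : Fin n} :
    (S.filter fun w => ClosedAdj G w v).card = 0 ↔ v ∈ undominated G S := by
  simp [Finset.filter_eq_empty_iff, mem_undominated]

theorem candidates_le (U : Finset (Fin n)) (v : Fin n) : candidates G U v ≤ n := by
  classical
  simpa [candidates] using Finset.card_le_univ (U.filter fun x => ClosedAdj G x v)

theorem selectVertex_halts (h : Encodes G S U s) :
    ∃ s', Halts selectVertex s (2 * (n * (3 * n + 5) + 2) + (n * 5 + 4) + 2) [s'] ∧
      Encodes G S U s' ∧ s'.reg 4 = s.reg 4 ∧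
      (∀ v : Fin n, s'.arr 3 v 0 = 0 ↔ v ∈ undominated G S) ∧
      ((s'.reg 2 = 0 ∧ Stuck G S U) ∨
        (s'.reg 2 ≠ 0 ∧ ∃ v : Fin n, v ∈ undominated G S ∧ s'.reg 3 = v ∧
          s'.reg 12 = n + 1 - candidates G U v ∧ 1 ≤ candidates G U v ∧
          ∀ w ∈ undominated G S, candidates G U v ≤ candidates G U w)) := by
  classical
  obtain ⟨s1, t1, f1, d1⟩ := countDominators_halts h
  have e1 := h.fillFrame f1 le_rfl
  have u1 : ∀ v : Fin n, s1.arr 3 v 0 = 0 ↔ v ∈ undominated G S := fun v => by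
    rw [d1, card_dominators_eq_zero]
  obtain ⟨s2, t2, f2, d2⟩ := fill_halts (a := 4) (e := .sub (.sub (.lit 1)
      (.sub (.add (closedEntry (.reg 10) (.reg 11)) (col 1 (.reg 11))) (.lit 1)))
      (col 3 (.reg 10)))
    (fun i j => 1 - (closedValue s1 i j + s1.arr 1 j 0 - 1) - s1.arr 3 i 0) e1.size
    (fun s' hf _ _ => by
      simp [Expr.eval, closedEntry, col, closedValue, hf.2 0 (by simp), hf.2 1 (by simp),
        hf.2 3 (by simp)])
  have e2 := e1.fillFrame f2 (by simp)
  have f23 := f2.2 3 (by simp)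
  obtain ⟨s3, t3, f3, d3, m3⟩ := argmax_halts
    (e := .add (col 4 (.reg 10)) (.sub (.lit 1) (col 3 (.reg 10))))
    (fun i => s2.arr 4 i 0 + (1 - s2.arr 3 i 0)) e2.size
    (fun s' hf _ => by simp [Expr.eval, col, hf.2])
  have e3 := e2.argmaxFrame f3
  have score : ∀ v : Fin n, s2.arr 4 v 0 + (1 - s2.arr 3 v 0) =
      if v ∈ undominated G S then n + 1 - candidates G U v else 0 := by
    intro v
    have hle := candidates_le (G := G) U v
    rw [d2, if_pos ⟨v.2, rfl⟩, f23]
    split_ifs with hv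
    · rw [(u1 v).2 hv]
      have : ∑ j ∈ Finset.range n, (1 - (closedValue s1 v j + s1.arr 1 j 0 - 1) - 0) =
          ((U.filter fun x => ClosedAdj G x v)ᶜ).card := by
        refine sum_range_eq_card fun w => ?_
        rw [e1.closedValue_eq, e1.undecided, ClosedAdj.comm]
        by_cases h1 : ClosedAdj G w v <;> by_cases h2 : w ∈ U <;> simp [h1, h2]
      rw [this, Finset.card_compl, Fintype.card_fin, ← candidates]
      omega
    · have h1 : 1 ≤ s1.arr 3 v 0 := Nat.one_le_iff_ne_zero.2 fun h => hv ((u1 v).1 h)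
      rw [Finset.sum_eq_zero fun j _ => by omega]
      omega
  refine ⟨_, (t1.seq_single (t2.seq_single (t3.seq_single
    ((Halts.assign _ _ _).seq_single (Halts.assign _ _ _))))).mono (by omega),
    (e3.setReg (by simp) _).setReg (by simp) _, ?_, ?_, ?_⟩
  · simp [Store.setReg, f3.1, f2.1, f1.1]
  · intro v
    simp only [Store.setReg]
    rw [f3.2, f23, u1]
  · have hn := e3.size
    by_cases hb : s3.reg 12 = 0
    · left
      refine ⟨by simp [Store.setReg, Expr.eval, hb], Or.inl ?_⟩
      refine Finset.eq_empty_iff_forall_notMem.2 fun v hv => ?_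
      have h1 := d3 v v.2
      have h2 := candidates_le (G := G) U v
      simp only [score, hv, if_true] at h1
      omega
    · obtain ⟨h1, h2⟩ := m3 hb
      obtain ⟨v, hv⟩ : ∃ v : Fin n, (v : ℕ) = s3.reg 13 := ⟨⟨_, h1⟩, rfl⟩
      rw [← hv, score] at h2
      have hle := candidates_le (G := G) U v
      have hvu : v ∈ undominated G S := by by_contra hvu; simp [hvu] at h2; omega
      rw [if_pos hvu] at h2
      have hmin : ∀ w ∈ undominated G S, candidates G U v ≤ candidates G U w := by
        intro w hw
        have h3 := d3 w w.2
        have := candidates_le (G := G) U w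
        simp only [score, hw, if_true] at h3
        omega
      by_cases hc : candidates G U v = 0
      · left
        refine ⟨?_, Or.inr ⟨v, hvu, hc⟩⟩
        simp only [Store.setReg, Expr.eval, hn, ← h2, hc, Nat.reduceEqDiff, if_false, if_true]
        omega
      · right
        refine ⟨?_, v, hvu, by simp [Store.setReg, Expr.eval, hv],
          by simp [Store.setReg, h2], by omega, hmin⟩
        simp only [Store.setReg, Expr.eval, hn, ← h2, Nat.reduceEqDiff, if_false, if_true]
        omega

theorem selectCandidate_halts (h : Encodes G S U s)
    (hu : ∀ v : Fin n, s.arr 3 v 0 = 0 ↔ v ∈ undominated G S) :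
    ∃ s', Halts selectCandidate s ((n * (3 * n + 5) + 2) + (n * 5 + 4) + 2) [s'] ∧
      Encodes G S U s' ∧ s'.reg 4 = s.reg 4 ∧ s'.reg 2 = s.reg 2 ∧
      ∀ v : Fin n, v ∈ undominated G S → s.reg 3 = v → s.reg 12 = n + 1 - candidates G U v →
        1 ≤ candidates G U v → (∀ w ∈ undominated G S, candidates G U v ≤ candidates G U w) →
        ∃ x : Fin n, s'.reg 5 = x ∧ IsPivot G (s.reg 4) S U x := by
  classical
  have hn := h.size
  have step : ∀ {s1 : Store}, Encodes G S U s1 → Encodes G S U (s1.setReg 5 (s1.reg 13)) :=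
    fun h => h.setReg (by simp) _
  have wit : ∀ v : Fin n, v ∈ undominated G S → 1 ≤ candidates G U v →
      ∃ x ∈ U, ClosedAdj G x v := fun v _ hv => by
    obtain ⟨x, hx⟩ := Finset.card_pos.1 hv
    exact ⟨x, (Finset.mem_filter.1 hx).1, (Finset.mem_filter.1 hx).2⟩
  have hgain : ∀ v x : Fin n, v ∈ undominated G S → ClosedAdj G x v → 1 ≤ gain G S x :=
    fun v x hv hx => Finset.card_pos.2 ⟨v, by simp only [Finset.mem_filter]; exact ⟨hv, hx⟩⟩
  by_cases hk : s.reg 4 + 1 - (n + 1 - s.reg 12) = 0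
  · obtain ⟨s1, t1, f1, d1⟩ := fill_halts (a := 5) (e := .sub (.sub (.add
        (closedEntry (.reg 10) (.reg 11)) (col 1 (.reg 10))) (.lit 1)) (col 3 (.reg 11)))
      (fun i j => closedValue s i j + s.arr 1 i 0 - 1 - s.arr 3 j 0) hn
      (fun s' hf _ _ => by
        simp [Expr.eval, closedEntry, col, closedValue, hf.2 0 (by simp), hf.2 1 (by simp),
          hf.2 3 (by simp)])
    have e1 := h.fillFrame f1 (by simp)
    obtain ⟨s2, t2, f2, d2, m2⟩ := argmax_halts (e := col 5 (.reg 10))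
      (fun i => s1.arr 5 i 0) e1.size (fun s' hf _ => by simp [Expr.eval, col, hf.2])
    have score : ∀ x : Fin n, s1.arr 5 x 0 = if x ∈ U then gain G S x else 0 := by
      intro x
      rw [d1, if_pos ⟨x.2, rfl⟩]
      split_ifs with hx
      · refine sum_range_eq_card fun w => ?_
        rw [h.closedValue_eq, h.undecided, if_pos hx]
        have := hu w
        by_cases h1 : ClosedAdj G x w <;> by_cases h2 : w ∈ undominated G S <;>
          simp [h1, h2] <;> simp [h2] at this <;> omega
      · refine Finset.sum_eq_zero fun j hj => ?_
        have := h.closedValue_eq x ⟨j, Finset.mem_range.1 hj⟩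
        simp only at this
        rw [this, h.undecided, if_neg hx]
        split_ifs <;> simp
    refine ⟨_, ((Halts.ite_false (by simpa [Expr.eval, hn] using hk)
      (t1.seq_single t2)).seq_single (Halts.assign _ _ _)).mono (by omega),
      step (e1.argmaxFrame f2), by simp [Store.setReg, f2.1, f1.1],
      by simp [Store.setReg, f2.1, f1.1], ?_⟩
    intro v hv _ hb hc hmin
    have hle := candidates_le (G := G) U v
    obtain ⟨x, hx, hxv⟩ := wit v hv hc
    have h1 := d2 x x.2
    simp only [score, hx, if_true] at h1
    have hb0 : s2.reg 12 ≠ 0 := by have := hgain v x hv hxv; omega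
    obtain ⟨h2, h3⟩ := m2 hb0
    obtain ⟨y, hy⟩ : ∃ y : Fin n, (y : ℕ) = s2.reg 13 := ⟨⟨_, h2⟩, rfl⟩
    rw [← hy, score] at h3
    have hyU : y ∈ U := by by_contra hyU; simp [hyU] at h3; omega
    rw [if_pos hyU] at h3
    refine ⟨y, by simp [Store.setReg, Expr.eval, hy], hyU, by omega, Or.inr ⟨fun w hw => ?_,
      fun z hz => ?_⟩⟩
    · have := hmin w hw
      omega
    · have := d2 z z.2
      simp only [score, hz, if_true] at this
      omega
  · obtain ⟨s1, t1, f1, d1, m1⟩ := argmax_halts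
      (e := .sub (.add (closedEntry (.reg 10) (.reg 3)) (col 1 (.reg 10))) (.lit 1))
      (fun i => closedValue s i (s.reg 3) + s.arr 1 i 0 - 1) hn
      (fun s' hf _ => by simp [Expr.eval, closedEntry, col, closedValue, hf.2, hf.1])
    refine ⟨_, ((Halts.ite_true (by simpa [Expr.eval, hn] using hk)
      t1).seq_single (Halts.assign _ _ _)).mono (by omega),
      step (h.argmaxFrame f1), by simp [Store.setReg, f1.1], by simp [Store.setReg, f1.1], ?_⟩
    intro v hv hr hb hc hmin
    have hle := candidates_le (G := G) U v
    have score : ∀ x : Fin n, closedValue s x (s.reg 3) + s.arr 1 x 0 - 1 =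
        if x ∈ U ∧ ClosedAdj G x v then 1 else 0 := by
      intro x
      rw [hr, h.closedValue_eq, h.undecided]
      by_cases h1 : ClosedAdj G x v <;> by_cases h2 : x ∈ U <;> simp [h1, h2]
    obtain ⟨x, hx, hxv⟩ := wit v hv hc
    have h1 := d1 x x.2
    simp only [score, hx, hxv, and_self, if_true] at h1
    obtain ⟨h2, h3⟩ := m1 (by omega)
    obtain ⟨y, hy⟩ : ∃ y : Fin n, (y : ℕ) = s1.reg 13 := ⟨⟨_, h2⟩, rfl⟩
    rw [← hy, score] at h3
    have hyU : y ∈ U ∧ ClosedAdj G y v := by by_contra hyU; simp [hyU] at h3; omega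
    exact ⟨y, by simp [Store.setReg, Expr.eval, hy], hyU.1, hgain v y hv hyU.2,
      Or.inl ⟨v, hv, hyU.2, by omega, hmin⟩⟩

/-- A bound for the number of steps of one round of the search on a branch. -/
def roundTime (n : ℕ) : ℕ := 3 * (n * (3 * n + 5) + 2) + 2 * (n * 5 + 4) + 8


/-- Induction on `|U|`, as every branching round removes a vertex from `U`. The extra round in the
bound is the one that detects a stuck state. -/
theorem searchLoop_halts (h : Encodes G S U s) (hd : Disjoint S U) (hflag : s.reg 2 ≠ 0) :
    ∃ ls l, Halts (.loop (.reg 2) searchRound) s ((U.card + 1) * (roundTime n + 1) + 1) ls ∧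
      Search G (s.reg 4) S U l ∧ List.Forall₂ (fun s' S' => ∃ U', Encodes G S' U' s') ls l := by
  classical
  induction hm : U.card using Nat.strong_induction_on generalizing S U s with
  | _ m ih =>
  obtain ⟨s1, t1, e1, k1, u1, hs⟩ := selectVertex_halts h
  obtain ⟨s2, t2, e2, k2, r2, hp⟩ := selectCandidate_halts e1 u1
  rcases hs with ⟨hz, hstuck⟩ | ⟨hz, v, hv, hr3, hr12, hc, hmin⟩
  · refine ⟨[s2], [S], ?_, .finish _ _ hstuck, by simpa using ⟨U, e2⟩⟩
    have h1 := (t1.seq_single t2).seq_single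
      (Halts.ite_false (e := .reg 2) (p := .seq (.store 1 (.reg 5) (.lit 0) (.lit 0))
        (.branch (.store 2 (.reg 5) (.lit 0) (.lit 1)) .skip))
        (by rw [Expr.eval, r2, hz]) (Halts.skip s2))
    have h2 := Halts.loop_true (e := .reg 2) (p := searchRound) (K := fun _ => [s2]) (H' := 1)
      (by simpa [Expr.eval] using hflag) h1 (by
        simpa using Halts.loop_false (e := .reg 2) (by rw [Expr.eval, r2, hz]))
    simp only [List.flatMap_cons, List.flatMap_nil, List.append_nil] at h2
    exact h2.mono (by rw [Nat.succ_mul m, roundTime]; omega)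
  · obtain ⟨x, hx, hpiv⟩ := hp v hv hr3 hr12 hc hmin
    have hxU := hpiv.1
    have hxS : x ∉ S := fun hxS => Finset.disjoint_left.1 hd hxS hxU
    have hcard : (U.erase x).card + 1 = m := by rw [Finset.card_erase_add_one hxU, hm]
    have e3 : Encodes G S (U.erase x) (s2.setArr 1 x 0 0) := by
      refine ⟨e2.size, by simpa [Store.setArr] using e2.adj, fun w => ?_,
        by simpa [Store.setArr] using e2.selected⟩
      by_cases hw : w = x
      · simp [Store.setArr, hw]
      · simp [Store.setArr, hw, Fin.ext_iff.not.1 hw, e2.undecided]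
    have e4 : Encodes G (insert x S) (U.erase x) ((s2.setArr 1 x 0 0).setArr 2 x 0 1) := by
      refine ⟨e3.size, by simpa [Store.setArr] using e3.adj,
        fun w => by rw [← e3.undecided w]; simp [Store.setArr], fun w => ?_⟩
      by_cases hw : w = x
      · simp [Store.setArr, hw]
      · simp [Store.setArr, hw, Fin.ext_iff.not.1 hw, e2.selected]
    set s3 := s2.setArr 1 x 0 0
    set s4 := s3.setArr 2 x 0 1
    -- The continuation in `Halts.loop_true` is a function of the state, so the two branches must
    -- end in different states.
    have hne : s3 ≠ s4 := by
      intro heq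
      have h1 := e3.selected x
      rw [heq, e4.selected] at h1
      simp [hxS] at h1
    have f3 : s3.reg 2 ≠ 0 := by
      change s2.reg 2 ≠ 0
      rwa [r2]
    have hk : s3.reg 4 = s.reg 4 := k2.trans k1
    obtain ⟨lsl, l, h4, g4, a4⟩ := ih _ (by omega) e4 (by
      rw [Finset.disjoint_insert_left]
      exact ⟨by simp, hd.mono_right (Finset.erase_subset _ _)⟩) f3 rfl
    obtain ⟨lsr, r, h3, g3, a3⟩ := ih _ (by omega) e3
      (hd.mono_right (Finset.erase_subset _ _)) f3 rfl
    rw [k1] at hpiv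
    rw [hk] at g3
    rw [show s4.reg 4 = s.reg 4 from hk] at g4
    refine ⟨lsl ++ lsr, l ++ r, ?_, ?_, List.rel_append a4 a3⟩
    · have h5 : Halts (.seq (.store 1 (.reg 5) (.lit 0) (.lit 0))
          (.branch (.store 2 (.reg 5) (.lit 0) (.lit 1)) .skip)) s2 3 ([s4] ++ [s3]) := by
        refine (Halts.store _ _ _ _ _).seq_single (H' := 2) ?_
        simp only [Expr.eval, hx]
        refine Halts.branch (H := 1) ?_ (Halts.skip _)
        have := Halts.store s3 2 (.reg 5) (.lit 0) (.lit 1)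
        simp only [Expr.eval] at this
        rwa [show s3.reg 5 = x from hx] at this
      have h6 := (t1.seq_single t2).seq_single (Halts.ite_true (e := .reg 2) (q := .skip)
        (by rwa [Expr.eval, r2]) h5)
      have h7 := Halts.loop_true (e := .reg 2) (p := searchRound)
        (K := fun s' => if s' = s3 then lsr else lsl)
        (by simpa [Expr.eval] using hflag) h6 (by
          intro s' hs'
          simp only [List.cons_append, List.nil_append, List.mem_cons, List.not_mem_nil,
            or_false] at hs'
          rcases hs' with rfl | rfl
          · simpa [hne.symm] using h4
          · simpa using h3)
      simp only [List.cons_append, List.nil_append, List.flatMap_cons, List.flatMap_nil,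
        List.append_nil, if_neg hne.symm, if_true] at h7
      refine h7.mono ?_
      rw [hcard, Nat.succ_mul m, roundTime]
      omega
    · convert Search.split S U x l r hpiv (by convert g4) (by convert g3)

/-- A dominating set is minimal if every vertex in it has a private neighbour. -/
theorem minimal_isDominatingSet_iff {V : Type*} {G : SimpleGraph V} {S : Finset V} :
    Minimal (IsDominatingSet G) S ↔ IsDominatingSet G S ∧
      ∀ x ∈ S, ∃ v, ClosedAdj G x v ∧ ∀ w ∈ S, ClosedAdj G w v → w = x := by
  classical
  constructor
  · refine fun h => ⟨h.1, fun x hx => ?_⟩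
    by_contra! hno
    have hdom : IsDominatingSet G (S.erase x) := by
      intro v
      obtain ⟨w, hw, hwv⟩ := h.1 v
      by_cases hwx : w = x
      · subst hwx
        obtain ⟨y, hy, hyv, hne⟩ := hno v hwv
        exact ⟨y, Finset.mem_erase.2 ⟨hne, hy⟩, hyv⟩
      · exact ⟨w, Finset.mem_erase.2 ⟨hwx, hw⟩, hwv⟩
    exact Finset.notMem_erase x S (h.2 hdom (Finset.erase_subset _ _) hx)
  · refine fun ⟨h1, h2⟩ => ⟨h1, fun T hT hTS x hx => ?_⟩
    obtain ⟨v, _, hv⟩ := h2 x hx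
    obtain ⟨w, hw, hwv⟩ := hT v
    exact hv w (hTS hw) hwv ▸ hw

open Classical in
theorem checkMinimal_halts (h : Encodes G S U s) :
    ∃ s', Halts checkMinimal s (2 * (n * (3 * n + 5) + 2) + (n * 5 + 4) + 1) [s'] ∧
      branchOutput n s' = if Minimal (IsDominatingSet G) S then some S else none := by
  obtain ⟨s1, t1, f1, d1⟩ := countDominators_halts h
  have e1 := h.fillFrame f1 le_rfl
  obtain ⟨s2, t2, f2, d2⟩ := fill_halts (a := 4)
    (e := .sub (closedEntry (.reg 10) (.reg 11)) (.sub (col 3 (.reg 11)) (.lit 1)))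
    (fun i j => closedValue s1 i j - (s1.arr 3 j 0 - 1)) e1.size
    (fun s' hf _ _ => by
      simp [Expr.eval, closedEntry, col, closedValue, hf.2 0 (by simp), hf.2 3 (by simp)])
  have e2 := e1.fillFrame f2 (by simp)
  have f23 := f2.2 3 (by simp)
  obtain ⟨s3, t3, f3, d3, m3⟩ := argmax_halts
    (e := .add (.sub (col 2 (.reg 10)) (col 4 (.reg 10))) (.sub (.lit 1) (col 3 (.reg 10))))
    (fun i => (s2.arr 2 i 0 - s2.arr 4 i 0) + (1 - s2.arr 3 i 0)) e2.size
    (fun s' hf _ => by simp [Expr.eval, col, hf.2])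
  have e3 := e2.argmaxFrame f3
  -- For `x ∈ S`, a summand is nonzero exactly when the vertex is dominated by `x` alone, so the sum
  -- counts private neighbours.
  have hpriv : ∀ x ∈ S, s2.arr 4 x 0 = 0 ↔
      ¬ ∃ v, ClosedAdj G x v ∧ ∀ w ∈ S, ClosedAdj G w v → w = x := by
    intro x hx
    rw [d2, if_pos ⟨x.2, rfl⟩, Finset.sum_range, Finset.sum_eq_zero_iff, not_exists]
    simp only [Finset.mem_univ, true_implies]
    refine forall_congr' fun v => ?_
    rw [e1.closedValue_eq, d1]
    by_cases hxv : ClosedAdj G x v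
    · simp only [hxv, if_true, true_and]
      have : (∀ w ∈ S, ClosedAdj G w v → w = x) ↔
          (S.filter fun w => ClosedAdj G w v).card ≤ 1 := by
        rw [Finset.card_le_one]
        simp only [Finset.mem_filter]
        exact ⟨fun h a ha b hb => (h a ha.1 ha.2).trans (h b hb.1 hb.2).symm,
          fun h w hw hwv => h w ⟨hw, hwv⟩ x ⟨hx, hxv⟩⟩
      rw [this]
      omega
    · simp [hxv]
  have hzero : s3.reg 12 = 0 ↔ Minimal (IsDominatingSet G) S := by
    have h1 : s3.reg 12 = 0 ↔
        ∀ v : Fin n, (s2.arr 2 v 0 - s2.arr 4 v 0) + (1 - s2.arr 3 v 0) = 0 := by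
      constructor
      · intro h0 v
        have := d3 v v.2
        omega
      · intro hall
        by_contra h0
        obtain ⟨h1, h2⟩ := m3 h0
        have := hall ⟨_, h1⟩
        simp only at this
        omega
    rw [h1, minimal_isDominatingSet_iff, isDominatingSet_iff_undominated,
      Finset.eq_empty_iff_forall_notMem, ← forall_and]
    refine forall_congr' fun v => ?_
    rw [← card_dominators_eq_zero, ← d1 v, f23, e2.selected]
    by_cases hv : v ∈ S
    · have := hpriv v hv
      simp only [hv, if_true, true_implies]
      rw [← not_iff_not.2 this |>.trans not_not]
      omega
    · simp only [hv, if_false, false_implies, and_true]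
      omega
  refine ⟨_, (t1.seq_single (t2.seq_single (t3.seq_single (Halts.assign _ _ _)))).mono
    (by omega), ?_⟩
  rw [← hzero, branchOutput]
  by_cases h0 : s3.reg 12 = 0
  · have : (Finset.univ.filter fun v : Fin n => s3.arr 2 v 0 ≠ 0) = S := by
      ext v; simp [e3.selected]
    simp [Store.setReg, Expr.eval, h0, this]
  · simp only [Store.setReg, Expr.eval, if_true, if_neg h0, ite_eq_left_iff]
    intro h
    omega

theorem encodes_inputStore (G : SimpleGraph (Fin n)) (X : Finset (Fin n)) :
    Encodes G ∅ X (inputStore G X) := by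
  refine ⟨by simp [inputStore], fun u v => ?_, fun v => ?_, by simp [inputStore]⟩
  · have : (∃ u' v' : Fin n, (u' : ℕ) = u ∧ (v' : ℕ) = v ∧ G.Adj u' v') ↔ G.Adj u v :=
      ⟨fun ⟨u', v', h1, h2, h3⟩ => Fin.ext h1 ▸ Fin.ext h2 ▸ h3, fun h => ⟨u, v, rfl, rfl, h⟩⟩
    by_cases hG : G.Adj u v <;> simp only [inputStore, if_true, this, hG, if_false]
  · simp [inputStore, Fin.val_inj]

theorem initializeSearch_halts (G : SimpleGraph (Fin n)) (X : Finset (Fin n)) :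
    ∃ s, Halts initializeSearch (inputStore G X) (3 * (n * (3 * n + 5) + 2) + 2) [s] ∧
      Encodes G ∅ X s ∧ s.reg 2 = 1 ∧
      s.reg 4 = 64 * (((Finset.range n).filter fun j => j * X.card < n).card + 1) := by
  have e0 := encodes_inputStore G X
  -- Column 1 of array `3` must read 0 in the multiplication, and entry `(0, 0)` of array `5` is
  -- never written when `n = 0`.
  have c0 : ∀ k l, (inputStore G X).arr 3 k l = 0 ∧ (inputStore G X).arr 5 k l = 0 := by
    simp [inputStore]
  set s := inputStore G X
  obtain ⟨s1, t1, f1, d1⟩ := fill_halts (a := 3) (e := col 1 (.reg 11))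
    (fun i j => s.arr 1 j 0) e0.size (fun s' hf _ _ => by simp [Expr.eval, col, hf.2 1 (by simp)])
  have e1 := e0.fillFrame f1 (by simp)
  rw [sum_range_eq_card (f := fun j => s.arr 1 j 0) (A := X) (by simpa using e0.undecided)] at d1
  obtain ⟨s2, t2, f2, d2⟩ := fill_halts (a := 4)
    (e := .get 3 (.lit 0) (.sub (.lit 1) (.sub (.reg 10) (.reg 11))))
    (fun i j => s1.arr 3 0 (1 - (i - j))) e1.size
    (fun s' hf _ _ => by simp [Expr.eval, hf.2 3 (by simp)])
  have e2 := e1.fillFrame f2 (by simp)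
  obtain ⟨s3, t3, f3, d3⟩ := fill_halts (a := 5)
    (e := .sub (.lit 1) (.sub (.lit 1) (.sub (.reg 0) (col 4 (.reg 11)))))
    (fun i j => 1 - (1 - (n - s2.arr 4 j 0))) e2.size
    (fun s' hf _ _ => by
      simp [Expr.eval, col, hf.2 4 (by simp), hf.1 0 (by simp) (by simp), e2.size])
  have e3 := e2.fillFrame f3 (by simp)
  have mult : ∀ i < n, s2.arr 4 i 0 = i * X.card := by
    intro i hi
    rw [d2, if_pos ⟨hi, rfl⟩]
    have : ∀ j ∈ Finset.range n, s1.arr 3 0 (1 - (i - j)) =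
        if j ∈ Finset.range i then X.card else 0 := by
      intro j hj
      rw [d1]
      by_cases hji : j < i
      · have h1 : 1 - (i - j) = 0 := by omega
        have h2 : 0 < n := by omega
        simp [hji, h1, h2]
      · have h1 : 1 - (i - j) ≠ 0 := by omega
        simp [hji, h1, (c0 _ _).1]
    rw [Finset.sum_congr rfl this, Finset.sum_ite_mem,
      Finset.inter_eq_right.2 (Finset.range_subset_range.2 hi.le)]
    simp
  have quot : s3.arr 5 0 0 = ((Finset.range n).filter fun j => j * X.card < n).card := by
    rw [d3, f2.2 5 (by simp), f1.2 5 (by simp), (c0 _ _).2, Finset.card_filter]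
    by_cases hn : 0 < n
    · rw [if_pos ⟨hn, rfl⟩]
      refine Finset.sum_congr rfl fun j hj => ?_
      rw [mult j (Finset.mem_range.1 hj)]
      split_ifs <;> omega
    · obtain rfl : n = 0 := by omega
      simp
  refine ⟨_, (t1.seq_single (t2.seq_single (t3.seq_single
    ((Halts.assign _ _ _).seq_single (Halts.assign _ _ _))))).mono (by omega),
    (e3.setReg (by simp) _).setReg (by simp) _, by simp [Store.setReg, Expr.eval], ?_⟩
  simp only [Store.setReg, Nat.reduceEqDiff, if_false, if_true, double, Expr.eval, col, quot]
  omega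

/-- The search tree of the algorithm. -/
theorem enumerateMinDom_spec (G : SimpleGraph (Fin n)) (X : Finset (Fin n)) :
    ∃ t l, EnumeratesMinDomIn enumerateMinDom G X t ∧
      Search G (64 * (((Finset.range n).filter fun j => j * X.card < n).card + 1)) ∅ X l ∧
      t.leaves.length = l.length ∧ t.height ≤ (n + 7) * (roundTime n + 1) := by
  classical
  obtain ⟨s, t0, e0, hf, hk⟩ := initializeSearch_halts G X
  obtain ⟨ls, l, h1, h2, h3⟩ := searchLoop_halts e0 (Finset.disjoint_empty_left _) (by simp [hf])
  rw [hk] at h2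
  -- The final state must be a function of `s'` alone; this is consistent because a store determines
  -- the selected set it encodes.
  have hcheck : ∀ s' : Store, ∃ s'', ∀ S' U', Encodes G S' U' s' →
      Halts checkMinimal s' (2 * (n * (3 * n + 5) + 2) + (n * 5 + 4) + 1) [s''] ∧
      branchOutput n s'' = if Minimal (IsDominatingSet G) S' then some S' else none := by
    intro s'
    by_cases h : ∃ S' U', Encodes G S' U' s'
    · obtain ⟨S', U', h⟩ := h
      obtain ⟨s'', g1, g2⟩ := checkMinimal_halts h
      refine ⟨s'', fun S₂ U₂ h' => ?_⟩
      obtain rfl : S₂ = S' := by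
        ext v
        have h3 := h.selected v
        rw [h'.selected v] at h3
        by_cases h4 : v ∈ S₂ <;> by_cases h5 : v ∈ S' <;> simp_all
      exact ⟨g1, g2⟩
    · exact ⟨s', fun S' U' h' => absurd ⟨S', U', h'⟩ h⟩
  choose c hc using hcheck
  obtain ⟨hls, hout⟩ : (∀ s' ∈ ls,
      Halts checkMinimal s' (2 * (n * (3 * n + 5) + 2) + (n * 5 + 4) + 1) [c s']) ∧
      (ls.map c).filterMap (branchOutput n) =
        l.filter fun S => Minimal (IsDominatingSet G) S := by
    clear h1 h2
    induction h3 with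
    | nil => simp
    | @cons s' S' ls l h _ ih =>
      obtain ⟨U', h⟩ := h
      refine ⟨by simpa using ⟨(hc s' S' U' h).1, ih.1⟩, ?_⟩
      rw [List.map_cons, List.filterMap_cons, (hc s' S' U' h).2, ih.2, List.filter_cons]
      by_cases hm : Minimal (IsDominatingSet G) S' <;> simp [hm]
  obtain ⟨t, g1, g2, g3⟩ := t0.seq_single (h1.seq (K := fun s' => [c s']) hls)
  have hmap : ls.flatMap (fun s' => [c s']) = ls.map c := by
    rw [List.map_eq_flatMap]
  rw [hmap] at g3
  refine ⟨t, l, ⟨g1, ?_, fun S => ?_⟩, h2, ?_, g2.trans ?_⟩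
  · rw [outputs, g3, hout]
    exact (h2.nodup (Finset.disjoint_empty_left _)).filter _
  · rw [outputs, g3, hout, List.mem_filter, decide_eq_true_iff, IsMinDomIn]
    constructor
    · rintro ⟨h4, h5⟩
      refine ⟨h5, fun v hv => ?_⟩
      simpa using (h2.bounds S h4).2 v hv
    · rintro ⟨h4, h5⟩
      exact ⟨h2.mem_of_minimal h4 (Finset.empty_subset _)
        fun v hv => Or.inr (h5 hv), h4⟩
  · rw [g3, List.length_map, h3.length_eq]
  · have h4 : X.card ≤ n := by simpa using Finset.card_le_univ X
    have h5 := Nat.mul_le_mul_right (roundTime n + 1) (Nat.succ_le_succ h4)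
    have h6 : (n + 7) * (roundTime n + 1) = (n + 1) * (roundTime n + 1) + 6 * (roundTime n + 1) := by
      ring
    rw [h6]
    refine le_trans (Nat.add_le_add_left (Nat.add_le_add_right (Nat.add_le_add_right h5 1) _) _) ?_
    have h7 : 3 * (n * (3 * n + 5) + 2) + 2 * (n * 5 + 4) + 8 = roundTime n := rfl
    generalize (n + 1) * (roundTime n + 1) = A at *
    omega

end Correctness

/-! ### The theorem -/

/-- The threshold computed by the algorithm is large enough, and bounded in terms of the density. -/
theorem card_multiples_bounds {n N D : ℕ} (hD : n ≤ D * N) :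
    n ≤ (((Finset.range n).filter fun j => j * N < n).card + 1) * N ∧
      ((Finset.range n).filter fun j => j * N < n).card + 1 ≤ D + 1 := by
  set q := ((Finset.range n).filter fun j => j * N < n).card with hq
  constructor
  · by_contra! hlt
    have hN : 1 ≤ N := by
      rcases Nat.eq_zero_or_pos N with rfl | h
      · omega
      · exact h
    -- If `(q + 1) N < n`, all of `0, …, q` would be counted, one more than `q`.
    have hsub : Finset.range (q + 1) ⊆ (Finset.range n).filter fun j => j * N < n := by
      intro j hj
      have h1 : j * N ≤ (q + 1) * N :=
        Nat.mul_le_mul_right N (by have := Finset.mem_range.1 hj; omega)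
      have h2 := Nat.le_mul_of_pos_right j hN
      simp only [Finset.mem_filter, Finset.mem_range]
      omega
    have := Finset.card_le_card hsub
    rw [Finset.card_range, ← hq] at this
    omega
  · have hsub : ((Finset.range n).filter fun j => j * N < n) ⊆ Finset.range D := by
      intro j hj
      exact Finset.mem_range.2
        (lt_of_mul_lt_mul_right ((Finset.mem_filter.1 hj).2.trans_le hD) (Nat.zero_le N))
    have := Finset.card_le_card hsub
    rw [Finset.card_range] at this
    omega

/-- The number of minimal dominating sets in `X` is at most the number of sets of a search. -/
theorem Search.ncard_le {V : Type*} [Fintype V] {G : SimpleGraph V} {k : ℕ} {X : Finset V}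
    {l : List (Finset V)} (h : Search G k ∅ X l) :
    {S : Finset V | IsMinDomIn G X S}.ncard ≤ l.length := by
  classical
  have hsub : {S : Finset V | IsMinDomIn G X S} ⊆ (l.toFinset : Set (Finset V)) := by
    rintro S ⟨h1, h2⟩
    simpa using h.mem_of_minimal h1 (Finset.empty_subset _) fun v hv => Or.inr (h2 hv)
  exact (Set.ncard_le_ncard hsub).trans
    (by rw [Set.ncard_coe_finset]; exact l.toFinset_card_le)

theorem mainTheorem4 :
    ∃ A : Program, ∀ d : ℝ, 0 < d → ∃ ε : ℝ, 0 < ε ∧ ε < 1 ∧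
      (∃ p : Polynomial ℕ, ∀ (n : ℕ) (G : SimpleGraph (Fin n)) (X : Finset (Fin n)),
        d * n ≤ X.card →
        ∃ t : SearchTree Store, EnumeratesMinDomIn A G X t ∧
          t.height ≤ p.eval n ∧
          (t.size : ℝ) ≤ (p.eval n : ℕ) * (2 - ε) ^ X.card) ∧
      (∃ C : ℝ, ∀ (V : Type*) [Fintype V] (G : SimpleGraph V) (X : Finset V),
        d * Fintype.card V ≤ X.card →
        ({S : Finset V | IsMinDomIn G X S}.ncard : ℝ) ≤ C * (2 - ε) ^ X.card) := by
  refine ⟨enumerateMinDom, fun d hd => ?_⟩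
  obtain ⟨D, hD⟩ := exists_nat_ge d⁻¹
  have density : ∀ n N : ℕ, d * n ≤ N → n ≤ D * N := by
    intro n N h
    have h1 : (n : ℝ) ≤ d⁻¹ * N := by rwa [le_inv_mul_iff₀ hd]
    exact_mod_cast h1.trans (mul_le_mul_of_nonneg_right hD (Nat.cast_nonneg N))
  -- The threshold computed by the machine depends on the input but never exceeds `D + 1`, so this
  -- `γ` depends on `d` only.
  set γ : ℝ := (1 / 2) ^ (64 * (D + 1)) with hγ
  have hγ0 : 0 < γ := by positivity
  have hγ1 : γ ≤ 1 := pow_le_one₀ (by norm_num) (by norm_num)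
  refine ⟨γ / 3, by positivity, by linarith, ⟨2 ^ (64 * (D + 1)) *
    ((Polynomial.X + 7) * (3 * (Polynomial.X * (3 * Polynomial.X + 5) + 2) +
      2 * (Polynomial.X * 5 + 4) + 9) + 1), fun n G X h => ?_⟩,
    2 ^ (64 * (D + 1)), fun V _ G X h => ?_⟩
  · have hn := density _ _ h
    obtain ⟨hq1, hq2⟩ := card_multiples_bounds hn
    obtain ⟨t, l, h1, h2, h3, h4⟩ := enumerateMinDom_spec G X
    have h5 := h2.length_le (Nat.le_add_left 1 _) hq2 (by simpa using hq1)
    set H := (n + 7) * (roundTime n + 1)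
    have heval : ((2 ^ (64 * (D + 1)) *
        ((Polynomial.X + 7) * (3 * (Polynomial.X * (3 * Polynomial.X + 5) + 2) +
        2 * (Polynomial.X * 5 + 4) + 9) + 1) : Polynomial ℕ)).eval n =
        2 ^ (64 * (D + 1)) * (H + 1) := by
      simp [H, roundTime]
    rw [heval]
    refine ⟨t, h1, ?_, ?_⟩
    · have := Nat.le_mul_of_pos_left (H + 1) (Nat.two_pow_pos (64 * (D + 1)))
      omega
    · have h6 : (t.size : ℝ) ≤ l.length * (H + 1 : ℕ) := by
        have := t.size_le.trans (Nat.mul_le_mul_left _ (Nat.succ_le_succ h4))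
        rw [h3] at this
        exact_mod_cast this
      refine h6.trans ((mul_le_mul_of_nonneg_right h5 (Nat.cast_nonneg _)).trans_eq ?_)
      push_cast
      ring
  · have hn := density _ _ h
    -- Any search bounds the count, so the threshold can be fixed from `D` directly.
    obtain ⟨l, hl⟩ := exists_search (G := G) (64 * (D + 1)) ∅ X
    have h1 := hl.length_le (Nat.le_add_left 1 D) le_rfl
      (hn.trans (Nat.mul_le_mul_right _ (Nat.le_succ D)))
    exact (Nat.cast_le.2 hl.ncard_le).trans h1
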